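/- Fix continuous or discrete time; let $\sigma$ denote the time derivative, respectively the forward unit shift, and let the stability domain be $\mathbb S=\{\lambda\in\mathbb C:\operatorname{Re}\lambda<0\}$, respectively $\mathbb S=\{\lambda\in\mathbb C:|\lambda|<1\}$. A realization $\sigma x=Ax+Bu$, $y=Cx+Du$ with real matrices has transfer function matrix (TFM) $D+C(\lambda I-A)^{-1}B\in\mathbb R(\lambda)^{\cdot\times\cdot}$; it is minimal if its order is the smallest among all realizations of its TFM, stabilizable if $[A-\lambda I\ \ B]$ has full row rank for all $\lambda\in\mathbb C\setminus\mathbb S$, and detectable if $[A^\top-\lambda I\ \ C^\top]$ has full row rank for all $\lambda\in\mathbb C\setminus\mathbb S$. A TFM is stable if it has no poles in $(\mathbb C\cup\{\infty\})\setminus\mathbb S$. A TFM $\mathbf K\in\mathbb R(\lambda)^{p\times m}$ is a stabilizing controller of $\mathbf G\in\mathbb R(\lambda)^{m\times p}$ if the feedback loop $z=r+y$, $u=\mathbf Kz$, $v=u+w$, $y=\mathbf Gv+\zeta$ has a well-defined closed-loop map from $(r,w,\zeta)$ to $(y,u,z,v)$ and this map is a stable TFM. **Theorem.** Let $\mathbf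 G\in\mathbb R(\lambda)^{m\times p}$ be given by a stabilizable and detectable realization $\sigma x=Ax+Bv$, $y=Cx+Dv+\zeta$, and let $\mathbf K\in\mathbb R(\lambda)^{p\times m}$ be a stabilizing controller of $\mathbf G$. Let $\mathbf K$ have a minimal realization of the form $$\left(\begin{bmatrix}A_{11}&A_{12}\\A_{21}&A_{22}\end{bmatrix},\ \begin{bmatrix}B_1\\B_2\end{bmatrix},\ \begin{bmatrix}I_p&O\end{bmatrix},\ O\right),\qquad A_{11}\in\mathbb R^{p\times p},\ A_{22}\in\mathbb R^{q\times q},$$ and let $(\mathbf W,\mathbf V)$ be a System Response-Type Realization (SRTR) pair generated by it, that is, for some $L\in\mathbb R^{q\times p}$, $$[\mathbf W\ \ \mathbf V]=[A_{11}-A_{12}L\ \ \ B_1]+A_{12}(\lambda I_q-A_{22}-LA_{12})^{-1}[LA_{11}-LA_{12}L+A_{21}-A_{22}L\ \ \ LB_1+B_2].$$ Suppose that $\mathbf W$ and $\mathbf V$ are stable. Put $\mathbf K_d:=[\tfrac1\lambda\mathbf W\ \ \tfrac1\lambda\mathbf V]$ and, for each $i\in\{1,\dots,p\}$, let $(\widetilde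 A_i,\widetilde B_i,\widetilde C_i,\widetilde D_i)$ be any stabilizable and detectable realization of the row $e_i^\top\mathbf K_d$, where $e_i$ is the $i$-th canonical basis vector of $\mathbb R^p$. Compute the commands as $\mathbf u=\mathbf K_d\,[(\mathbf u+\boldsymbol\delta_u)^\top\ \mathbf z^\top]^\top$ ($\delta_u$ being a communication disturbance) by implementing these $p$ realizations, $$\sigma\xi_i=\widetilde A_i\xi_i+\widetilde B_i\begin{bmatrix}u+\delta_u\\z\end{bmatrix},\qquad u_i=\widetilde C_i\xi_i+\widetilde D_i\begin{bmatrix}u+\delta_u\\z\end{bmatrix},\qquad i=1,\dots,p,$$ with $z=r+y$ and $v=u+w$. Then the dynamics of the closed-loop state $(x,\xi_1,\dots,\xi_p)$ are asymptotically stable: when $r$, $w$, $\zeta$, $\delta_u$ all vanish, every initial state is the start of a trajectory on $t\ge 0$, the origin is stable in the sense of Lyapunov, and every trajectory tends to the origin as $t\to\infty$. -/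

import Mathlib

open scoped Topology Matrix

noncomputable section

namespace LTI

/-- The two kinds of linear time-invariant systems. -/
inductive TimeDomain where
  | continuous
  | discrete

/-- The domain of stability `𝕊`: the open left half-plane in continuous time, the open unit disk in
discrete time. -/
def TimeDomain.stabilityDomain : TimeDomain → Set ℂ
  | .continuous => {l | l.re < 0}
  | .discrete => {l | ‖l‖ < 1}

/-- The type of time instants (only instants `t ≥ 0` are ever used). -/
def TimeDomain.Time : TimeDomain → Type
  | .continuous => ℝ
  | .discrete => ℕ

instance TimeDomain.instZeroTime : (𝕋 : TimeDomain) → Zero 𝕋.Time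
  | .continuous => inferInstanceAs (Zero ℝ)
  | .discrete => inferInstanceAs (Zero ℕ)

instance TimeDomain.instPreorderTime : (𝕋 : TimeDomain) → Preorder 𝕋.Time
  | .continuous => inferInstanceAs (Preorder ℝ)
  | .discrete => inferInstanceAs (Preorder ℕ)

/-- `HasSigma 𝕋 x d t` says `(σ x)(t) = d`, where `σ` is the time derivative in continuous time
(one-sided at the initial instant `0`) and the forward unit shift in discrete time. -/
def HasSigma {E : Type} [NormedAddCommGroup E] [NormedSpace ℝ E] :
    (𝕋 : TimeDomain) → (𝕋.Time → E) → E → 𝕋.Time → Prop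
  | .continuous => fun (x : ℝ → E) d (t : ℝ) => HasDerivWithinAt x d (Set.Ici 0) t
  | .discrete => fun (x : ℕ → E) d (t : ℕ) => x (t + 1) = d

/-- A transfer function matrix (TFM): a matrix of real rational functions of the indeterminate `λ`,
which is `RatFunc.X`. Rows are indexed by outputs `ο`, columns by inputs `κ`. -/
abbrev TFM (ο κ : Type) : Type := Matrix ο κ (RatFunc ℝ)

/-- A TFM is stable if it has no poles in `ℂ ∪ {∞}` outside of `𝕊`. The poles of a TFM are those of
its entries; an entry has no pole at `∞` iff it is proper, and its finite poles are the complex roots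
of its reduced denominator. -/
def IsStableTFM {ο κ : Type} (𝕋 : TimeDomain) (G : TFM ο κ) : Prop :=
  ∀ i j, (G i j).num.degree ≤ (G i j).denom.degree ∧
    ∀ l : ℂ, Polynomial.aeval l (G i j).denom = 0 → l ∈ 𝕋.stabilityDomain

/-- The pair `(A, B)` is controllable at `l ∈ ℂ`: `[A - l I  B]` has full row rank. -/
def ControllableAt {ι κ : Type} [Fintype ι] [DecidableEq ι] [Fintype κ]
    (A : Matrix ι ι ℝ) (B : Matrix ι κ ℝ) (l : ℂ) : Prop :=
  (Matrix.fromCols (A.map ((↑) : ℝ → ℂ) - l • (1 : Matrix ι ι ℂ))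
    (B.map ((↑) : ℝ → ℂ))).rank = Fintype.card ι

/-- The pair `(C, A)` is observable at `l ∈ ℂ`. -/
def ObservableAt {ι ο : Type} [Fintype ι] [DecidableEq ι] [Fintype ο]
    (C : Matrix ο ι ℝ) (A : Matrix ι ι ℝ) (l : ℂ) : Prop :=
  ControllableAt Aᵀ Cᵀ l

/-- A state-space realization `σ x = A x + B u`, `y = C x + D u`, with states indexed by `ι`, inputs
by `κ` and outputs by `ο`. -/
structure Realization (ι κ ο : Type) where
  A : Matrix ι ι ℝ
  B : Matrix ι κ ℝ
  C : Matrix ο ι ℝ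
  D : Matrix ο κ ℝ

namespace Realization

variable {ι κ ο : Type} [Fintype ι] [DecidableEq ι]

/-- The TFM `D + C (λ I - A)⁻¹ B` of a realization. -/
def tfm (R : Realization ι κ ο) : TFM ο κ :=
  R.D.map RatFunc.C + R.C.map RatFunc.C *
    ((RatFunc.X : RatFunc ℝ) • (1 : Matrix ι ι (RatFunc ℝ)) - R.A.map RatFunc.C)⁻¹ *
      R.B.map RatFunc.C

/-- Stabilizability: controllability at every `l ∈ ℂ \ 𝕊`. -/
def IsStabilizable [Fintype κ] (R : Realization ι κ ο) (𝕋 : TimeDomain) : Prop :=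
  ∀ l : ℂ, l ∉ 𝕋.stabilityDomain → ControllableAt R.A R.B l

/-- Detectability: observability at every `l ∈ ℂ \ 𝕊`. -/
def IsDetectable [Fintype ο] (R : Realization ι κ ο) (𝕋 : TimeDomain) : Prop :=
  ∀ l : ℂ, l ∉ 𝕋.stabilityDomain → ObservableAt R.C R.A l

/-- A realization is minimal if its order is the smallest among all realizations of its TFM. -/
def IsMinimal (R : Realization ι κ ο) : Prop :=
  ∀ (k : ℕ) (R' : Realization (Fin k) κ ο), R'.tfm = R.tfm → Fintype.card ι ≤ k

end Realization

/-- The realization `σ(y, q) = [A₁₁ A₁₂; A₂₁ A₂₂] (y, q) + [B₁; B₂] u`, `y = [I 0] (y, q)`, in which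
the output is the first part of the state. -/
def outputFirst {p q m : ℕ} (A₁₁ : Matrix (Fin p) (Fin p) ℝ) (A₁₂ : Matrix (Fin p) (Fin q) ℝ)
    (A₂₁ : Matrix (Fin q) (Fin p) ℝ) (A₂₂ : Matrix (Fin q) (Fin q) ℝ)
    (B₁ : Matrix (Fin p) (Fin m) ℝ) (B₂ : Matrix (Fin q) (Fin m) ℝ) :
    Realization (Fin p ⊕ Fin q) (Fin m) (Fin p) where
  A := Matrix.fromBlocks A₁₁ A₁₂ A₂₁ A₂₂
  B := Matrix.fromRows B₁ B₂
  C := Matrix.fromCols 1 0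
  D := 0

/-- The realization of `[W V]`, for the System Response-Type Realization (SRTR) pair `(W, V)`
generated by the matrix `L` from the realization `outputFirst A₁₁ A₁₂ A₂₁ A₂₂ B₁ B₂`. -/
def srtrRealization {p q m : ℕ} (A₁₁ : Matrix (Fin p) (Fin p) ℝ) (A₁₂ : Matrix (Fin p) (Fin q) ℝ)
    (A₂₁ : Matrix (Fin q) (Fin p) ℝ) (A₂₂ : Matrix (Fin q) (Fin q) ℝ)
    (B₁ : Matrix (Fin p) (Fin m) ℝ) (B₂ : Matrix (Fin q) (Fin m) ℝ)
    (L : Matrix (Fin q) (Fin p) ℝ) :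
    Realization (Fin q) (Fin p ⊕ Fin m) (Fin p) where
  A := A₂₂ + L * A₁₂
  B := Matrix.fromCols (L * A₁₁ - L * A₁₂ * L + A₂₁ - A₂₂ * L) (L * B₁ + B₂)
  C := A₁₂
  D := Matrix.fromCols (A₁₁ - A₁₂ * L) B₁

/-- The implementation `K_d = [λ⁻¹ W  λ⁻¹ V]` of a controller with SRTR pair `(W, V)`. -/
def srtrImplementation {p m : ℕ} (W : TFM (Fin p) (Fin p)) (V : TFM (Fin p) (Fin m)) :
    TFM (Fin p) (Fin p ⊕ Fin m) :=
  Matrix.fromCols ((RatFunc.X : RatFunc ℝ)⁻¹ • W) ((RatFunc.X : RatFunc ℝ)⁻¹ • V)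

/-- The equations of the feedback loop of the plant `G` with the controller `K`:
`z = r + y`, `u = K z`, `v = u + w`, `y = G v + ζ`. -/
def LoopEquations {p m : ℕ} (K : TFM (Fin p) (Fin m)) (G : TFM (Fin m) (Fin p))
    (r : Fin m → RatFunc ℝ) (w : Fin p → RatFunc ℝ) (ζ : Fin m → RatFunc ℝ)
    (y : Fin m → RatFunc ℝ) (u : Fin p → RatFunc ℝ) (z : Fin m → RatFunc ℝ)
    (v : Fin p → RatFunc ℝ) : Prop :=
  z = r + y ∧ u = K *ᵥ z ∧ v = u + w ∧ y = G *ᵥ v + ζ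

/-- `K` is a stabilizing controller for `G`: the feedback loop is internally stable, that is, the
closed-loop map `T` from the exogenous signals `(r, w, ζ)` to the internal ones `(y, u, z, v)` exists
(the loop equations are uniquely solvable, with solution `T (r, w, ζ)`) and it is a stable TFM. -/
def IsStabilizingController {p m : ℕ} (𝕋 : TimeDomain) (K : TFM (Fin p) (Fin m))
    (G : TFM (Fin m) (Fin p)) : Prop :=
  ∃ T : TFM ((Fin m ⊕ Fin p) ⊕ (Fin m ⊕ Fin p)) (Fin m ⊕ (Fin p ⊕ Fin m)),
    (∀ r w ζ y u z v, LoopEquations K G r w ζ y u z v ↔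
      Sum.elim (Sum.elim y u) (Sum.elim z v) = T *ᵥ Sum.elim r (Sum.elim w ζ)) ∧
    IsStableTFM 𝕋 T

/-- The state of the closed loop: the plant's state, and the state of each of the `p` subsystems of
the controller's implementation. -/
abbrev ClosedLoopState {p : ℕ} (n : ℕ) (k : Fin p → ℕ) : Type :=
  (Fin n → ℝ) × ((i : Fin p) → Fin (k i) → ℝ)

/-- `X` is a state trajectory, on `t ≥ 0`, of the closed loop formed by the plant (with the given
realization) and by the `p` controller subsystems, the `i`-th of which is realized by `R i`, is fed
with `(u + δ, z)` and computes the command `uᵢ`. The signals `r`, `w`, `ζ` and the communication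
disturbance `δ` are exogenous; `y`, `u`, `z = r + y` and `v = u + w` are internal. -/
def IsClosedLoopTrajectory {m p n : ℕ} {k : Fin p → ℕ} (𝕋 : TimeDomain)
    (plant : Realization (Fin n) (Fin p) (Fin m))
    (R : (i : Fin p) → Realization (Fin (k i)) (Fin p ⊕ Fin m) (Fin 1))
    (r : 𝕋.Time → Fin m → ℝ) (w : 𝕋.Time → Fin p → ℝ) (ζ : 𝕋.Time → Fin m → ℝ)
    (δ : 𝕋.Time → Fin p → ℝ) (X : 𝕋.Time → ClosedLoopState n k) : Prop :=
  ∃ (y : 𝕋.Time → Fin m → ℝ) (u : 𝕋.Time → Fin p → ℝ) (z : 𝕋.Time → Fin m → ℝ)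
    (v : 𝕋.Time → Fin p → ℝ), ∀ t : 𝕋.Time, 0 ≤ t →
      HasSigma 𝕋 (fun s => (X s).1) (plant.A *ᵥ (X t).1 + plant.B *ᵥ v t) t ∧
      y t = plant.C *ᵥ (X t).1 + plant.D *ᵥ v t + ζ t ∧
      v t = u t + w t ∧
      z t = r t + y t ∧
      ∀ i : Fin p,
        HasSigma 𝕋 (fun s => (X s).2 i)
          ((R i).A *ᵥ (X t).2 i + (R i).B *ᵥ Sum.elim (u t + δ t) (z t)) t ∧
        u t i = ((R i).C *ᵥ (X t).2 i + (R i).D *ᵥ Sum.elim (u t + δ t) (z t)) 0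

/-- The closed-loop state dynamics are asymptotically stable: with all exogenous signals equal to
zero, there is a trajectory from every initial state, the origin is Lyapunov stable, and every
trajectory tends to the origin. -/
def ClosedLoopAsymptoticallyStable {m p n : ℕ} {k : Fin p → ℕ} (𝕋 : TimeDomain)
    (plant : Realization (Fin n) (Fin p) (Fin m))
    (R : (i : Fin p) → Realization (Fin (k i)) (Fin p ⊕ Fin m) (Fin 1)) : Prop :=
  (∀ X₀ : ClosedLoopState n k, ∃ X : 𝕋.Time → ClosedLoopState n k,
    IsClosedLoopTrajectory 𝕋 plant R 0 0 0 0 X ∧ X 0 = X₀) ∧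
  (∀ ε : ℝ, 0 < ε → ∃ η : ℝ, 0 < η ∧ ∀ X : 𝕋.Time → ClosedLoopState n k,
    IsClosedLoopTrajectory 𝕋 plant R 0 0 0 0 X → ‖X 0‖ < η → ∀ t, 0 ≤ t → ‖X t‖ < ε) ∧
  (∀ X : 𝕋.Time → ClosedLoopState n k,
    IsClosedLoopTrajectory 𝕋 plant R 0 0 0 0 X → Filter.Tendsto X Filter.atTop (𝓝 0))

end LTI

end

/-! Since `[W V]` is proper, every row of `K_d = [λ⁻¹ W λ⁻¹ V]` vanishes at infinity, so its
realizations have no feedthrough. The commands then depend on the states alone, the algebraic loop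
disappears, and the autonomous closed loop is a linear system `σ X = f X`. It suffices that `f` has
no eigenvalue outside the stability domain.

Let `l` lie outside it. An eigenvector for `l` consists of states solving the pencil equations of
the plant and of all subsystems, with shared signals `(u, y)`. The work is to show `u = 0` and `y =
0`; detectability of each realization then kills the states. Poles at `l` forbid substituting `λ =
l` in `G`, `K` or `K_d` (`K_d` may have a pole at `0`, which is not in the continuous stability
domain). A pencil solution is therefore translated into a limit, as `z → l`, of input-output pairs
of the transfer matrix: controllability at `l` gives the limit (`exists_tendsto_of_controllableAt`),
observability at `l` recovers a state from it (`exists_state_of_observableAt`).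

Stabilizability of the subsystems, after multiplication by `λ`, gives `l u = W(l) u + V(l) y`. The
SRTR realization inherits observability from the minimal realization of `K`, so this relation has a
state, which a shift by `L u` turns into a pencil solution for `K`. Hence `(y, u)` is a limiting
pair of `K`, while `(u, y)` is one of `G` by stabilizability of the plant. The stable closed-loop
map is continuous at `l` and sends loop mismatches to loop signals; the mismatches tend to zero, so
the signals have limit zero (`IsStabilizingController.eq_zero_of_tendsto`). -/

noncomputable section

namespace LTI

open Filter

/-! ### Evaluation of rational matrices at complex points -/

section Evaluation

/-- The value at a complex number of a real rational function. -/
def evalC (f : RatFunc ℝ) (z : ℂ) : ℂ := f.eval (algebraMap ℝ ℂ) z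

/-- The value at a complex number of a matrix of real rational functions. -/
def evalM {ο κ : Type} (M : Matrix ο κ (RatFunc ℝ)) (z : ℂ) : Matrix ο κ ℂ :=
  M.map fun f => evalC f z

/-- The complex matrix with the same entries as a real one. -/
abbrev cplx {ο κ : Type} (M : Matrix ο κ ℝ) : Matrix ο κ ℂ := M.map ((↑) : ℝ → ℂ)

/-- At a root of the denominator `RatFunc.eval` returns the junk value of a division by zero, so
evaluation respects sums and products only off a finite set. This is why the identities below hold
along `cofinite`. -/
theorem eventually_denom_ne_zero (f : RatFunc ℝ) :
    ∀ᶠ z : ℂ in cofinite, f.denom.eval₂ (algebraMap ℝ ℂ) z ≠ 0 := by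
  have h : f.denom.map (algebraMap ℝ ℂ) ≠ 0 := by
    rw [Polynomial.map_ne_zero_iff (algebraMap ℝ ℂ).injective]
    exact f.denom_ne_zero
  refine ((Polynomial.finite_setOfPred_isRoot h).subset ?_ : Set.Finite _)
  intro z hz
  simpa [Polynomial.IsRoot, Polynomial.eval_map] using hz

theorem evalC_zero (z : ℂ) : evalC 0 z = 0 := RatFunc.eval_zero _ _

theorem evalC_one (z : ℂ) : evalC 1 z = 1 := RatFunc.eval_one _ _

theorem evalC_C (c : ℝ) (z : ℂ) : evalC (RatFunc.C c) z = c := RatFunc.eval_C _ _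

theorem evalC_X (z : ℂ) : evalC RatFunc.X z = z := RatFunc.eval_X _ _

theorem evalC_add (f g : RatFunc ℝ) :
    ∀ᶠ z : ℂ in cofinite, evalC (f + g) z = evalC f z + evalC g z := by
  filter_upwards [eventually_denom_ne_zero f, eventually_denom_ne_zero g] with z hf hg
  exact RatFunc.eval_add _ _ hf hg

theorem evalC_mul (f g : RatFunc ℝ) :
    ∀ᶠ z : ℂ in cofinite, evalC (f * g) z = evalC f z * evalC g z := by
  filter_upwards [eventually_denom_ne_zero f, eventually_denom_ne_zero g] with z hf hg
  exact RatFunc.eval_mul _ _ hf hg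

theorem evalC_neg (f : RatFunc ℝ) :
    ∀ᶠ z : ℂ in cofinite, evalC (-f) z = -evalC f z := by
  filter_upwards [evalC_add f (-f)] with z h
  rw [add_neg_cancel, evalC_zero] at h
  exact (neg_eq_of_add_eq_zero_right h.symm).symm

theorem evalC_sum {α : Type} (s : Finset α) (f : α → RatFunc ℝ) :
    ∀ᶠ z : ℂ in cofinite, evalC (∑ a ∈ s, f a) z = ∑ a ∈ s, evalC (f a) z := by
  classical
  induction s using Finset.induction_on with
  | empty => simp [evalC_zero]
  | insert a s ha ih =>
    filter_upwards [ih, evalC_add (f a) (∑ a ∈ s, f a)] with z h1 h2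
    rw [Finset.sum_insert ha, Finset.sum_insert ha, h2, h1]

variable {ι κ ο μ : Type}

theorem evalM_map_C (M : Matrix ο κ ℝ) (z : ℂ) : evalM (M.map RatFunc.C) z = cplx M := by
  ext i j
  simp [evalM, evalC_C]

theorem evalM_one [DecidableEq ι] (z : ℂ) : evalM (1 : Matrix ι ι (RatFunc ℝ)) z = 1 := by
  ext i j
  by_cases h : i = j <;> simp [evalM, Matrix.one_apply, h, evalC_zero, evalC_one]

theorem evalM_zero (z : ℂ) : evalM (0 : Matrix ο κ (RatFunc ℝ)) z = 0 := by
  ext i j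
  simp [evalM, evalC_zero]

theorem evalM_add [Finite ο] [Finite κ] (M N : Matrix ο κ (RatFunc ℝ)) :
    ∀ᶠ z : ℂ in cofinite, evalM (M + N) z = evalM M z + evalM N z := by
  have h : ∀ᶠ z : ℂ in cofinite, ∀ i j, evalC (M i j + N i j) z = evalC (M i j) z + evalC (N i j) z :=
    eventually_all.2 fun i => eventually_all.2 fun j => evalC_add _ _
  filter_upwards [h] with z hz
  ext i j
  exact hz i j

theorem evalM_neg [Finite ο] [Finite κ] (M : Matrix ο κ (RatFunc ℝ)) :
    ∀ᶠ z : ℂ in cofinite, evalM (-M) z = -evalM M z := by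
  have h : ∀ᶠ z : ℂ in cofinite, ∀ i j, evalC (-M i j) z = -evalC (M i j) z :=
    eventually_all.2 fun i => eventually_all.2 fun j => evalC_neg _
  filter_upwards [h] with z hz
  ext i j
  exact hz i j

theorem evalM_smul [Finite ο] [Finite κ] (f : RatFunc ℝ) (M : Matrix ο κ (RatFunc ℝ)) :
    ∀ᶠ z : ℂ in cofinite, evalM (f • M) z = evalC f z • evalM M z := by
  have h : ∀ᶠ z : ℂ in cofinite, ∀ i j, evalC (f * M i j) z = evalC f z * evalC (M i j) z :=
    eventually_all.2 fun i => eventually_all.2 fun j => evalC_mul _ _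
  filter_upwards [h] with z hz
  ext i j
  exact hz i j

theorem evalM_mul [Finite ο] [Fintype κ] [Finite μ] (M : Matrix ο κ (RatFunc ℝ))
    (N : Matrix κ μ (RatFunc ℝ)) :
    ∀ᶠ z : ℂ in cofinite, evalM (M * N) z = evalM M z * evalM N z := by
  have h : ∀ᶠ z : ℂ in cofinite, ∀ i j,
      evalC (∑ a, M i a * N a j) z = ∑ a, evalC (M i a * N a j) z :=
    eventually_all.2 fun i => eventually_all.2 fun j => evalC_sum _ _
  have h' : ∀ᶠ z : ℂ in cofinite, ∀ i a j,
      evalC (M i a * N a j) z = evalC (M i a) z * evalC (N a j) z :=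
    eventually_all.2 fun i => eventually_all.2 fun a => eventually_all.2 fun j => evalC_mul _ _
  filter_upwards [h, h'] with z hz hz'
  ext i j
  simp only [evalM, Matrix.mul_apply, Matrix.map_apply, hz, hz']

theorem continuousAt_evalC {f : RatFunc ℝ} {l : ℂ} (h : Polynomial.aeval l f.denom ≠ 0) :
    ContinuousAt (evalC f) l := by
  unfold evalC RatFunc.eval
  simp only [← Polynomial.aeval_def]
  exact (Polynomial.continuous_aeval _).continuousAt.div (Polynomial.continuous_aeval _).continuousAt h

theorem IsStableTFM.continuousAt_evalM {𝕋 : TimeDomain} {G : TFM ο κ} (hG : IsStableTFM 𝕋 G) {l : ℂ}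
    (hl : l ∉ 𝕋.stabilityDomain) : ContinuousAt (evalM G) l := by
  refine continuousAt_pi.2 fun i => continuousAt_pi.2 fun j => ?_
  exact continuousAt_evalC fun h => hl ((hG i j).2 l h)

/-- Transfers identities valid off finitely many points to limits at `l`, even if `l` is one of the
exceptions. -/
theorem nhdsNE_le_cofinite (l : ℂ) : 𝓝[≠] l ≤ cofinite := by
  rw [le_cofinite_iff_eventually_ne]
  intro x
  rcases eq_or_ne x l with rfl | h
  · exact eventually_mem_nhdsWithin
  · exact (eventually_ne_nhds h.symm).filter_mono nhdsWithin_le_nhds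

end Evaluation

/-! ### Pencils: rank conditions, one-sided inverses and eigenvector tests -/

theorem det_X_smul_one_sub_ne_zero {ι : Type} [Fintype ι] [DecidableEq ι] (A : Matrix ι ι ℝ) :
    ((RatFunc.X : RatFunc ℝ) • (1 : Matrix ι ι (RatFunc ℝ)) - A.map RatFunc.C).det ≠ 0 := by
  have h : (RatFunc.X : RatFunc ℝ) • (1 : Matrix ι ι (RatFunc ℝ)) - A.map RatFunc.C =
      (algebraMap (Polynomial ℝ) (RatFunc ℝ)).mapMatrix A.charmatrix := by
    ext i j
    by_cases hij : i = j
    · subst hij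
      simp [Matrix.charmatrix_apply_eq, RatFunc.algebraMap_X, RatFunc.algebraMap_C]
    · simp [hij, RatFunc.algebraMap_C]
  rw [h, ← RingHom.map_det]
  exact RatFunc.algebraMap_ne_zero A.charpoly_monic.ne_zero

theorem exists_mul_eq_one_of_controllableAt {ι κ : Type} [Fintype ι] [DecidableEq ι] [Fintype κ]
    {A : Matrix ι ι ℝ} {B : Matrix ι κ ℝ} {l : ℂ} (h : ControllableAt A B l) :
    ∃ S : Matrix (ι ⊕ κ) ι ℂ, Matrix.fromCols (cplx A - l • 1) (cplx B) * S = 1 := by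
  classical
  rw [← Matrix.mulVec_surjective_iff_exists_right_inverse]
  have h1 : LinearMap.range
      (Matrix.fromCols (cplx A - l • (1 : Matrix ι ι ℂ)) (cplx B)).mulVecLin = ⊤ := by
    apply Submodule.eq_top_of_finrank_eq
    rw [Module.finrank_fintype_fun_eq_card]
    exact h
  exact LinearMap.range_eq_top.1 h1

theorem exists_mul_eq_one_of_observableAt {ι ο : Type} [Fintype ι] [DecidableEq ι] [Fintype ο]
    {C : Matrix ο ι ℝ} {A : Matrix ι ι ℝ} {l : ℂ} (h : ObservableAt C A l) :
    ∃ S : Matrix ι (ι ⊕ ο) ℂ, S * Matrix.fromRows (cplx A - l • 1) (cplx C) = 1 := by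
  obtain ⟨S, hS⟩ := exists_mul_eq_one_of_controllableAt h
  refine ⟨Sᵀ, ?_⟩
  have h2 := congrArg Matrix.transpose hS
  rw [Matrix.transpose_mul, Matrix.transpose_one, Matrix.transpose_fromCols] at h2
  have h3 : (cplx Aᵀ - l • (1 : Matrix ι ι ℂ))ᵀ = cplx A - l • 1 := by
    rw [Matrix.transpose_sub, Matrix.transpose_smul, Matrix.transpose_one]
    rfl
  rw [h3] at h2
  exact h2

/-- Popov–Belevitch–Hautus test: the row rank is full once the transposed pencil is injective, and
its kernel consists of left eigenvectors of `A` annihilating `B`. -/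
theorem controllableAt_of_vecMul {ι κ : Type} [Fintype ι] [DecidableEq ι] [Fintype κ]
    {A : Matrix ι ι ℝ} {B : Matrix ι κ ℝ} {l : ℂ}
    (h : ∀ x : ι → ℂ, x ᵥ* cplx A = l • x → x ᵥ* cplx B = 0 → x = 0) : ControllableAt A B l := by
  unfold ControllableAt
  rw [← Matrix.rank_transpose, Matrix.rank]
  rw [LinearMap.finrank_range_of_inj, Module.finrank_fintype_fun_eq_card]
  rw [← LinearMap.ker_eq_bot, LinearMap.ker_eq_bot']
  intro x hx
  rw [Matrix.mulVecLin_apply, Matrix.mulVec_transpose, Matrix.vecMul_fromCols] at hx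
  refine h x ?_ ?_
  · funext i
    have := congrFun hx (Sum.inl i)
    simpa [Matrix.vecMul_sub, Matrix.vecMul_smul, sub_eq_zero] using this
  · funext i
    exact congrFun hx (Sum.inr i)

theorem observableAt_of_mulVec {ι ο : Type} [Fintype ι] [DecidableEq ι] [Fintype ο]
    {C : Matrix ο ι ℝ} {A : Matrix ι ι ℝ} {l : ℂ}
    (h : ∀ x : ι → ℂ, cplx A *ᵥ x = l • x → cplx C *ᵥ x = 0 → x = 0) : ObservableAt C A l := by
  refine controllableAt_of_vecMul fun x h1 h2 => h x ?_ ?_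
  · rw [← h1, ← Matrix.mulVec_transpose]; rfl
  · rw [← h2, ← Matrix.mulVec_transpose]; rfl

theorem ObservableAt.eq_zero {ι ο : Type} [Fintype ι] [DecidableEq ι] [Fintype ο]
    {C : Matrix ο ι ℝ} {A : Matrix ι ι ℝ} {l : ℂ} (h : ObservableAt C A l) {x : ι → ℂ}
    (h1 : (cplx A - l • 1) *ᵥ x = 0) (h2 : cplx C *ᵥ x = 0) : x = 0 := by
  obtain ⟨S, hS⟩ := exists_mul_eq_one_of_observableAt h
  have h3 : Matrix.fromRows (cplx A - l • 1) (cplx C) *ᵥ x = 0 := by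
    rw [Matrix.fromRows_mulVec, h1, h2]
    ext (i | i) <;> rfl
  rw [← Matrix.one_mulVec x, ← hS, ← Matrix.mulVec_mulVec, h3, Matrix.mulVec_zero]

/-! ### Limits of linear systems -/

theorem tendsto_mulVec {α ι κ : Type} [Fintype κ] {F : Filter α} {M : α → Matrix ι κ ℂ}
    {v : α → κ → ℂ} {M₀ : Matrix ι κ ℂ} {v₀ : κ → ℂ} (hM : Tendsto M F (𝓝 M₀))
    (hv : Tendsto v F (𝓝 v₀)) : Tendsto (fun a => M a *ᵥ v a) F (𝓝 (M₀ *ᵥ v₀)) := by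
  refine tendsto_pi_nhds.2 fun i => ?_
  refine tendsto_finsetSum _ fun j _ => ?_
  exact (tendsto_pi_nhds.1 (tendsto_pi_nhds.1 hM i) j).mul (tendsto_pi_nhds.1 hv j)

theorem tendsto_const_mulVec {α ι κ : Type} [Fintype κ] {F : Filter α} (M : Matrix ι κ ℂ)
    {v : α → κ → ℂ} {v₀ : κ → ℂ} (hv : Tendsto v F (𝓝 v₀)) :
    Tendsto (fun a => M *ᵥ v a) F (𝓝 (M *ᵥ v₀)) :=
  tendsto_mulVec tendsto_const_nhds hv

/-- Solutions of a linear system with converging coefficients converge when the limit of the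
coefficient matrix is the identity. -/
theorem tendsto_of_mulVec_eq {α ι : Type} [Fintype ι] [DecidableEq ι] {F : Filter α}
    {E : α → Matrix ι ι ℂ} {x h : α → ι → ℂ} {h₀ : ι → ℂ} (hE : Tendsto E F (𝓝 1))
    (hh : Tendsto h F (𝓝 h₀)) (hx : ∀ᶠ a in F, E a *ᵥ x a = h a) : Tendsto x F (𝓝 h₀) := by
  have hdet : Tendsto (fun a => (E a).det) F (𝓝 1) := by
    have : Continuous fun M : Matrix ι ι ℂ => M.det := continuous_id.matrix_det
    have h1 := (this.tendsto 1).comp hE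
    rwa [Matrix.det_one] at h1
  -- Cramer's rule: the solution is `det⁻¹ • adjugate *ᵥ h`, and both factors are continuous in the
  -- coefficients.
  have hadj : Tendsto (fun a => (E a).adjugate *ᵥ h a) F (𝓝 h₀) := by
    have h1 : Continuous fun M : Matrix ι ι ℂ => M.adjugate := continuous_id.matrix_adjugate
    have h2 := tendsto_mulVec ((h1.tendsto 1).comp hE) hh
    rwa [Matrix.adjugate_one, Matrix.one_mulVec] at h2
  have hlim := (hdet.inv₀ one_ne_zero).smul hadj
  simp only [inv_one, one_smul] at hlim
  refine hlim.congr' ?_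
  filter_upwards [hx, hdet.eventually_ne one_ne_zero] with a ha hd
  rw [← ha, Matrix.mulVec_mulVec, Matrix.adjugate_mul, Matrix.smul_mulVec, Matrix.one_mulVec,
    inv_smul_smul₀ hd]

/-! ### Pencil solutions and limiting input-output pairs -/

namespace Realization

variable {ι κ ο : Type} [Fintype ι] [DecidableEq ι]

/-- The resolvent `(λ I - A)⁻¹` of the state matrix. -/
def resolvent (R : Realization ι κ ο) : Matrix ι ι (RatFunc ℝ) :=
  ((RatFunc.X : RatFunc ℝ) • (1 : Matrix ι ι (RatFunc ℝ)) - R.A.map RatFunc.C)⁻¹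

theorem eventually_evalM (R : Realization ι κ ο) [Finite κ] [Finite ο] :
    ∀ᶠ z : ℂ in cofinite, evalM R.resolvent z * (z • 1 - cplx R.A) = 1 ∧
      (z • 1 - cplx R.A) * evalM R.resolvent z = 1 ∧
      evalM R.tfm z = cplx R.D + cplx R.C * evalM R.resolvent z * cplx R.B := by
  have hdet := (det_X_smul_one_sub_ne_zero R.A).isUnit
  set P := (RatFunc.X : RatFunc ℝ) • (1 : Matrix ι ι (RatFunc ℝ)) - R.A.map RatFunc.C with hP
  have hP' : P = (RatFunc.X : RatFunc ℝ) • (1 : Matrix ι ι (RatFunc ℝ)) + (-R.A).map RatFunc.C := by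
    ext i j
    simp [hP, sub_eq_add_neg]
  filter_upwards [evalM_mul R.resolvent P, evalM_mul P R.resolvent,
    evalM_smul (RatFunc.X : RatFunc ℝ) (1 : Matrix ι ι (RatFunc ℝ)),
    evalM_add ((RatFunc.X : RatFunc ℝ) • (1 : Matrix ι ι (RatFunc ℝ))) ((-R.A).map RatFunc.C),
    evalM_add (R.D.map RatFunc.C) (R.C.map RatFunc.C * R.resolvent * R.B.map RatFunc.C),
    evalM_mul (R.C.map RatFunc.C * R.resolvent) (R.B.map RatFunc.C),
    evalM_mul (R.C.map RatFunc.C) R.resolvent] with z h1 h2 h3 h4 h5 h6 h7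
  have hPz : evalM P z = z • 1 - cplx R.A := by
    rw [hP', h4, h3, evalM_one, evalM_map_C, evalC_X]
    ext i j
    simp [sub_eq_add_neg]
  refine ⟨?_, ?_, ?_⟩
  · rw [← hPz, ← h1, ← evalM_one z, resolvent, Matrix.nonsing_inv_mul _ hdet]
  · rw [← hPz, ← h2, ← evalM_one z, resolvent, Matrix.mul_nonsing_inv _ hdet]
  · rw [evalM_map_C, h6, h7, evalM_map_C, evalM_map_C] at h5
    exact h5

variable [Fintype κ] [Fintype ο]

/-- At a point where the realization is controllable, each solution of the pencil equations is a
limit of input-output pairs of the transfer function matrix. -/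
theorem exists_tendsto_of_controllableAt (R : Realization ι κ ο) {l : ℂ}
    (hc : ControllableAt R.A R.B l) {x₀ : ι → ℂ} {u₀ : κ → ℂ}
    (h : (cplx R.A - l • 1) *ᵥ x₀ + cplx R.B *ᵥ u₀ = 0) :
    ∃ (u : ℂ → κ → ℂ) (y : ℂ → ο → ℂ), Tendsto u (𝓝[≠] l) (𝓝 u₀) ∧
      Tendsto y (𝓝[≠] l) (𝓝 (cplx R.C *ᵥ x₀ + cplx R.D *ᵥ u₀)) ∧
      ∀ᶠ z in 𝓝[≠] l, y z = evalM R.tfm z *ᵥ u z := by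
  obtain ⟨S, hS⟩ := exists_mul_eq_one_of_controllableAt hc
  set N : ℂ → Matrix ι (ι ⊕ κ) ℂ := fun z => Matrix.fromCols (cplx R.A - z • 1) (cplx R.B) with hN
  set s₀ : ι ⊕ κ → ℂ := Sum.elim x₀ u₀ with hs₀
  -- Correct `s₀` into the kernel of `N z` using the right inverse `S` of `N l`. Scaling by the
  -- determinant replaces the inverse of `N z * S` by its adjugate, so `s` is continuous everywhere;
  -- at `l` the correction vanishes and the determinant is `1`.
  set s : ℂ → ι ⊕ κ → ℂ := fun z =>
    (N z * S).det • s₀ - S *ᵥ ((N z * S).adjugate *ᵥ (N z *ᵥ s₀)) with hs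
  have hNs : ∀ z, N z *ᵥ s z = 0 := by
    intro z
    simp only [hs, Matrix.mulVec_sub, Matrix.mulVec_smul]
    rw [Matrix.mulVec_mulVec, Matrix.mulVec_mulVec, Matrix.mul_adjugate, Matrix.smul_mulVec,
      Matrix.one_mulVec, sub_self]
  have hNl : N l *ᵥ s₀ = 0 := by
    simp only [hN, hs₀, Matrix.fromCols_mulVec_sumElim]
    exact h
  have hsl : s l = s₀ := by
    have : N l * S = 1 := hS
    simp only [hs, this, hNl, Matrix.mulVec_zero, Matrix.det_one, one_smul, sub_zero]
  have hNc : Continuous N := by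
    refine continuous_matrix fun i j => ?_
    rcases j with j | j
    · simp only [hN, Matrix.fromCols_apply_inl, Matrix.sub_apply, Matrix.smul_apply]
      fun_prop
    · simp only [hN, Matrix.fromCols_apply_inr]
      fun_prop
  have hsc : Continuous s := by
    have h1 : Continuous fun z => N z * S := hNc.matrix_mul continuous_const
    refine (h1.matrix_det.smul continuous_const).sub ?_
    exact continuous_const.matrix_mulVec
      (h1.matrix_adjugate.matrix_mulVec (hNc.matrix_mulVec continuous_const))
  have hst : Tendsto s (𝓝[≠] l) (𝓝 s₀) := by
    have := (hsc.tendsto l).mono_left (nhdsWithin_le_nhds (s := {l}ᶜ))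
    rwa [hsl] at this
  have hut : Tendsto (fun z j => s z (Sum.inr j)) (𝓝[≠] l) (𝓝 u₀) :=
    tendsto_pi_nhds.2 fun j => (tendsto_pi_nhds.1 hst) (Sum.inr j)
  have hxt : Tendsto (fun z j => s z (Sum.inl j)) (𝓝[≠] l) (𝓝 x₀) :=
    tendsto_pi_nhds.2 fun j => (tendsto_pi_nhds.1 hst) (Sum.inl j)
  refine ⟨fun z j => s z (Sum.inr j),
    fun z => cplx R.C *ᵥ (fun j => s z (Sum.inl j)) + cplx R.D *ᵥ (fun j => s z (Sum.inr j)),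
    hut, ?_, ?_⟩
  · exact (tendsto_const_mulVec _ hxt).add (tendsto_const_mulVec _ hut)
  · filter_upwards [R.eventually_evalM.filter_mono (nhdsNE_le_cofinite l)] with z hz
    obtain ⟨h1, -, h3⟩ := hz
    set x : ι → ℂ := fun j => s z (Sum.inl j)
    set u : κ → ℂ := fun j => s z (Sum.inr j)
    have hxu : (z • 1 - cplx R.A) *ᵥ x = cplx R.B *ᵥ u := by
      have h4 := hNs z
      have h5 : s z = Sum.elim x u := (Sum.elim_comp_inl_inr (s z)).symm
      simp only [hN] at h4
      rw [h5, Matrix.fromCols_mulVec_sumElim] at h4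
      rw [← neg_sub, Matrix.neg_mulVec]
      exact neg_eq_of_add_eq_zero_right h4
    have hx : x = evalM R.resolvent z *ᵥ (cplx R.B *ᵥ u) := by
      rw [← hxu, Matrix.mulVec_mulVec, h1, Matrix.one_mulVec]
    rw [h3, Matrix.add_mulVec, hx]
    simp only [Matrix.mulVec_mulVec, Matrix.mul_assoc]
    rw [add_comm]

/-- At a point where the realization is observable, each limit of input-output pairs of the transfer
function matrix comes from a solution of the pencil equations. -/
theorem exists_state_of_observableAt (R : Realization ι κ ο) {l : ℂ}
    (ho : ObservableAt R.C R.A l) {u : ℂ → κ → ℂ} {y : ℂ → ο → ℂ} {u₀ : κ → ℂ} {y₀ : ο → ℂ}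
    (hu : Tendsto u (𝓝[≠] l) (𝓝 u₀)) (hy : Tendsto y (𝓝[≠] l) (𝓝 y₀))
    (h : ∀ᶠ z in 𝓝[≠] l, y z = evalM R.tfm z *ᵥ u z) :
    ∃ x₀ : ι → ℂ, (cplx R.A - l • 1) *ᵥ x₀ + cplx R.B *ᵥ u₀ = 0 ∧
      cplx R.C *ᵥ x₀ + cplx R.D *ᵥ u₀ = y₀ := by
  obtain ⟨S, hS⟩ := exists_mul_eq_one_of_observableAt ho
  set x : ℂ → ι → ℂ := fun z => evalM R.resolvent z *ᵥ (cplx R.B *ᵥ u z) with hx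
  have hx1 : ∀ᶠ z in 𝓝[≠] l, (cplx R.A - z • 1) *ᵥ x z = -(cplx R.B *ᵥ u z) := by
    filter_upwards [R.eventually_evalM.filter_mono (nhdsNE_le_cofinite l)] with z hz
    rw [← neg_sub, Matrix.neg_mulVec, hx, Matrix.mulVec_mulVec, hz.2.1, Matrix.one_mulVec]
  have hx2 : ∀ᶠ z in 𝓝[≠] l, cplx R.C *ᵥ x z = y z - cplx R.D *ᵥ u z := by
    filter_upwards [R.eventually_evalM.filter_mono (nhdsNE_le_cofinite l), h] with z hz hyz
    rw [hyz, hz.2.2, Matrix.add_mulVec, add_sub_cancel_left, hx]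
    simp only [Matrix.mulVec_mulVec, Matrix.mul_assoc]
  have hBu : Tendsto (fun z => cplx R.B *ᵥ u z) (𝓝[≠] l) (𝓝 (cplx R.B *ᵥ u₀)) :=
    tendsto_const_mulVec _ hu
  have hDu : Tendsto (fun z => cplx R.D *ᵥ u z) (𝓝[≠] l) (𝓝 (cplx R.D *ᵥ u₀)) :=
    tendsto_const_mulVec _ hu
  -- The resolvent may blow up at `l`, but the state also satisfies the output equation. Multiplying
  -- the stacked equations by the left inverse `S` at `l` gives a system with coefficient matrix
  -- tending to `1`, so the states converge.
  set E : ℂ → Matrix ι ι ℂ := fun z => S * Matrix.fromRows (cplx R.A - z • 1) (cplx R.C) with hE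
  have hAc : Continuous fun z : ℂ => cplx R.A - z • (1 : Matrix ι ι ℂ) := by fun_prop
  have hEt : Tendsto E (𝓝[≠] l) (𝓝 1) := by
    have hEc : Continuous E := by
      refine continuous_const.matrix_mul (continuous_matrix fun i j => ?_)
      rcases i with i | i
      · simp only [Matrix.fromRows_apply_inl, Matrix.sub_apply, Matrix.smul_apply]
        fun_prop
      · simp only [Matrix.fromRows_apply_inr]
        fun_prop
    have := (hEc.tendsto l).mono_left (nhdsWithin_le_nhds (s := {l}ᶜ))
    rwa [show E l = 1 from hS] at this
  have hrhs : Tendsto (fun z => S *ᵥ Sum.elim (-(cplx R.B *ᵥ u z)) (y z - cplx R.D *ᵥ u z))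
      (𝓝[≠] l) (𝓝 (S *ᵥ Sum.elim (-(cplx R.B *ᵥ u₀)) (y₀ - cplx R.D *ᵥ u₀))) := by
    refine tendsto_const_mulVec _ ?_
    refine tendsto_pi_nhds.2 fun i => ?_
    rcases i with i | i
    · exact tendsto_pi_nhds.1 hBu.neg i
    · exact tendsto_pi_nhds.1 (hy.sub hDu) i
  have hxt := tendsto_of_mulVec_eq (x := x) hEt hrhs <| by
    filter_upwards [hx1, hx2] with z h1 h2
    rw [hE, ← Matrix.mulVec_mulVec, Matrix.fromRows_mulVec, h1, h2]
  set x₀ := S *ᵥ Sum.elim (-(cplx R.B *ᵥ u₀)) (y₀ - cplx R.D *ᵥ u₀)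
  refine ⟨x₀, ?_, ?_⟩
  · have hAx : Tendsto (fun z => (cplx R.A - z • 1) *ᵥ x z) (𝓝[≠] l)
        (𝓝 ((cplx R.A - l • 1) *ᵥ x₀)) :=
      tendsto_mulVec ((hAc.tendsto l).mono_left nhdsWithin_le_nhds) hxt
    rw [tendsto_nhds_unique (hAx.congr' hx1) hBu.neg, neg_add_cancel]
  · have hCx : Tendsto (fun z => cplx R.C *ᵥ x z) (𝓝[≠] l) (𝓝 (cplx R.C *ᵥ x₀)) :=
      tendsto_const_mulVec _ hxt
    rw [tendsto_nhds_unique (hCx.congr' hx2) (hy.sub hDu), sub_add_cancel]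

/-- The value at infinity of a transfer function matrix is its feedthrough matrix. -/
theorem tendsto_evalM_tfm_mulVec (R : Realization ι κ ο) (v : κ → ℂ) :
    Tendsto (fun z => evalM R.tfm z *ᵥ v) (Bornology.cobounded ℂ) (𝓝 (cplx R.D *ᵥ v)) := by
  have hcof : Bornology.cobounded ℂ ≤ cofinite :=
    Metric.cobounded_le_cocompact.trans cocompact_le_cofinite
  have hinv : Tendsto (fun z : ℂ => z⁻¹) (Bornology.cobounded ℂ) (𝓝 0) :=
    tendsto_inv₀_cobounded
  -- Dividing the state equation by `z` makes its coefficient matrix tend to `1` and its right-hand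
  -- side to `0`.
  have hE : Tendsto (fun z : ℂ => 1 - z⁻¹ • cplx R.A) (Bornology.cobounded ℂ) (𝓝 1) := by
    have := (tendsto_const_nhds (x := (1 : Matrix ι ι ℂ))).sub (hinv.smul_const (cplx R.A))
    rwa [zero_smul, sub_zero] at this
  have hh : Tendsto (fun z : ℂ => z⁻¹ • (cplx R.B *ᵥ v)) (Bornology.cobounded ℂ) (𝓝 0) := by
    have := hinv.smul_const (cplx R.B *ᵥ v)
    rwa [zero_smul] at this
  have hx := tendsto_of_mulVec_eq (x := fun z => evalM R.resolvent z *ᵥ (cplx R.B *ᵥ v)) hE hh <| by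
    filter_upwards [R.eventually_evalM.filter_mono hcof,
      hcof (show ∀ᶠ z : ℂ in cofinite, z ≠ 0 from eventually_cofinite_ne 0)] with z hz h0
    have h1 : 1 - z⁻¹ • cplx R.A = z⁻¹ • (z • 1 - cplx R.A) := by
      rw [smul_sub, inv_smul_smul₀ h0]
    rw [h1, Matrix.smul_mulVec, Matrix.mulVec_mulVec, hz.2.1, Matrix.one_mulVec]
  have hy := (tendsto_const_nhds (x := cplx R.D *ᵥ v)).add (tendsto_const_mulVec (cplx R.C) hx)
  rw [Matrix.mulVec_zero, add_zero] at hy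
  refine hy.congr' ?_
  filter_upwards [R.eventually_evalM.filter_mono hcof] with z hz
  rw [hz.2.2, Matrix.add_mulVec]
  simp only [Matrix.mulVec_mulVec, Matrix.mul_assoc]

end Realization

/-! ### Minimality implies observability and controllability -/

theorem re_cplx_mulVec {ο κ : Type} [Fintype κ] (M : Matrix ο κ ℝ) (x : κ → ℂ) (i : ο) :
    ((cplx M *ᵥ x) i).re = (M *ᵥ fun j => (x j).re) i := by
  simp [Matrix.mulVec, dotProduct, Complex.re_sum]

theorem im_cplx_mulVec {ο κ : Type} [Fintype κ] (M : Matrix ο κ ℝ) (x : κ → ℂ) (i : ο) :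
    ((cplx M *ᵥ x) i).im = (M *ᵥ fun j => (x j).im) i := by
  simp [Matrix.mulVec, dotProduct, Complex.im_sum]

namespace Realization

variable {ι κ ο : Type} [Fintype ι] [DecidableEq ι]

/-- Two realizations whose states are related by a linear map have the same transfer function
matrix. -/
theorem tfm_eq_of_intertwining {ι' : Type} [Fintype ι'] [DecidableEq ι'] {R : Realization ι κ ο}
    {R' : Realization ι' κ ο} (P : Matrix ι' ι ℝ) (hA : P * R.A = R'.A * P) (hB : P * R.B = R'.B)
    (hC : R.C = R'.C * P) (hD : R.D = R'.D) : R'.tfm = R.tfm := by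
  have h1 := (det_X_smul_one_sub_ne_zero R.A).isUnit
  have h2 := (det_X_smul_one_sub_ne_zero R'.A).isUnit
  unfold tfm
  set E := (RatFunc.X : RatFunc ℝ) • (1 : Matrix ι ι (RatFunc ℝ)) - R.A.map RatFunc.C with hE
  set E' := (RatFunc.X : RatFunc ℝ) • (1 : Matrix ι' ι' (RatFunc ℝ)) - R'.A.map RatFunc.C with hE'
  have h3 : P.map RatFunc.C * E = E' * P.map RatFunc.C := by
    rw [hE, hE', Matrix.mul_sub, Matrix.sub_mul, ← Matrix.map_mul, ← Matrix.map_mul, hA]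
    simp
  have h4 : E'⁻¹ * P.map RatFunc.C = P.map RatFunc.C * E⁻¹ := by
    calc E'⁻¹ * P.map RatFunc.C = E'⁻¹ * (P.map RatFunc.C * E) * E⁻¹ := by
          rw [Matrix.mul_assoc, Matrix.mul_assoc, Matrix.mul_nonsing_inv _ h1, Matrix.mul_one]
      _ = P.map RatFunc.C * E⁻¹ := by
          rw [h3, ← Matrix.mul_assoc, Matrix.nonsing_inv_mul _ h2, Matrix.one_mul]
  rw [hD, hC, ← hB, Matrix.map_mul, Matrix.map_mul]
  simp only [Matrix.mul_assoc]
  rw [← Matrix.mul_assoc E'⁻¹, h4, Matrix.mul_assoc]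

/-- Factoring out a nonzero unobservable subspace reduces the order of a realization. -/
theorem exists_smaller (R : Realization ι κ ο) {N : Submodule ℝ (ι → ℝ)} (hN : N ≠ ⊥)
    (hA : ∀ x ∈ N, R.A *ᵥ x ∈ N) (hC : ∀ x ∈ N, R.C *ᵥ x = 0) :
    ∃ k < Fintype.card ι, ∃ R' : Realization (Fin k) κ ο, R'.tfm = R.tfm := by
  set k := Module.finrank ℝ ((ι → ℝ) ⧸ N)
  set e : ((ι → ℝ) ⧸ N) ≃ₗ[ℝ] (Fin k → ℝ) := (Module.finBasis ℝ ((ι → ℝ) ⧸ N)).equivFun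
  set π : (ι → ℝ) →ₗ[ℝ] (Fin k → ℝ) := e.toLinearMap ∘ₗ N.mkQ with hπ
  have hker : ∀ x, π x = 0 ↔ x ∈ N := by
    intro x
    simp [hπ]
  -- A linear section represents the quotient maps by matrices. Its choice is immaterial: `x - g (π
  -- x)` lies in `N`, which `A` preserves and `C` kills.
  obtain ⟨g, hg⟩ := π.exists_rightInverse_of_surjective
    (LinearMap.range_eq_top.2 (e.surjective.comp N.mkQ_surjective))
  have hgπ : ∀ x, x - g (π x) ∈ N := by
    intro x
    rw [← hker, map_sub, ← LinearMap.comp_apply π g, hg, LinearMap.id_apply, sub_self]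
  set P := LinearMap.toMatrix' π
  set Q := LinearMap.toMatrix' g
  have hP : ∀ x, P *ᵥ x = π x := fun x => LinearMap.toMatrix'_mulVec π x
  have hQ : ∀ x, Q *ᵥ x = g x := fun x => LinearMap.toMatrix'_mulVec g x
  refine ⟨k, ?_, ⟨P * R.A * Q, P * R.B, R.C * Q, R.D⟩, ?_⟩
  · have h1 := N.finrank_quotient_add_finrank
    have h2 : 0 < Module.finrank ℝ N := Submodule.one_le_finrank_iff.2 hN
    rw [Module.finrank_fintype_fun_eq_card] at h1
    omega
  · refine tfm_eq_of_intertwining P ?_ rfl ?_ rfl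
    · refine Matrix.ext_of_mulVec_single fun i => ?_
      simp only [← Matrix.mulVec_mulVec, hP, hQ]
      rw [← sub_eq_zero, ← map_sub, ← Matrix.mulVec_sub, hker]
      exact hA _ (hgπ _)
    · refine Matrix.ext_of_mulVec_single fun i => ?_
      simp only [← Matrix.mulVec_mulVec, hP, hQ]
      rw [← sub_eq_zero, ← Matrix.mulVec_sub]
      exact hC _ (hgπ _)

/-- The real and imaginary parts of an unobservable complex eigenvector span a real subspace that is
invariant and unobservable. If nonzero, it could be factored out, contradicting minimality. -/
theorem IsMinimal.observableAt [Fintype ο] {R : Realization ι κ ο} (hR : R.IsMinimal) (l : ℂ) :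
    ObservableAt R.C R.A l := by
  refine observableAt_of_mulVec fun x hx hCx => ?_
  set a : ι → ℝ := fun j => (x j).re with ha
  set b : ι → ℝ := fun j => (x j).im with hb
  have hAa : R.A *ᵥ a = l.re • a - l.im • b := by
    funext i
    rw [← re_cplx_mulVec, hx]
    simp [ha, hb]
  have hAb : R.A *ᵥ b = l.re • b + l.im • a := by
    funext i
    rw [← im_cplx_mulVec, hx]
    simp [ha, hb]
  have hCa : R.C *ᵥ a = 0 := by
    funext i
    rw [← re_cplx_mulVec, hCx]
    rfl
  have hCb : R.C *ᵥ b = 0 := by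
    funext i
    rw [← im_cplx_mulVec, hCx]
    rfl
  have hN : Submodule.span ℝ {a, b} = ⊥ := by
    by_contra hN
    have hinv : ∀ v ∈ Submodule.span ℝ {a, b}, R.A *ᵥ v ∈ Submodule.span ℝ {a, b} := by
      intro v hv
      obtain ⟨s, t, rfl⟩ := Submodule.mem_span_pair.1 hv
      rw [Matrix.mulVec_add, Matrix.mulVec_smul, Matrix.mulVec_smul, hAa, hAb]
      have h1 : a ∈ Submodule.span ℝ {a, b} := Submodule.subset_span (by simp)
      have h2 : b ∈ Submodule.span ℝ {a, b} := Submodule.subset_span (by simp)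
      exact add_mem (Submodule.smul_mem _ _ (sub_mem (Submodule.smul_mem _ _ h1)
        (Submodule.smul_mem _ _ h2))) (Submodule.smul_mem _ _ (add_mem (Submodule.smul_mem _ _ h2)
        (Submodule.smul_mem _ _ h1)))
    have hout : ∀ v ∈ Submodule.span ℝ {a, b}, R.C *ᵥ v = 0 := by
      intro v hv
      obtain ⟨s, t, rfl⟩ := Submodule.mem_span_pair.1 hv
      rw [Matrix.mulVec_add, Matrix.mulVec_smul, Matrix.mulVec_smul, hCa, hCb, smul_zero, smul_zero,
        add_zero]
    obtain ⟨k, hk, R', hR'⟩ := R.exists_smaller hN hinv hout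
    exact absurd (hR k R' hR') (not_le.2 hk)
  rw [Submodule.span_eq_bot] at hN
  funext j
  exact Complex.ext (congrFun (hN a (by simp)) j) (congrFun (hN b (by simp)) j)

/-- The dual realization. -/
def dual (R : Realization ι κ ο) : Realization ι ο κ := ⟨R.Aᵀ, R.Cᵀ, R.Bᵀ, R.Dᵀ⟩

theorem tfm_dual (R : Realization ι κ ο) : R.dual.tfm = R.tfmᵀ := by
  have h : (RatFunc.X : RatFunc ℝ) • (1 : Matrix ι ι (RatFunc ℝ)) - R.Aᵀ.map RatFunc.C =
      ((RatFunc.X : RatFunc ℝ) • (1 : Matrix ι ι (RatFunc ℝ)) - R.A.map RatFunc.C)ᵀ := by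
    rw [Matrix.transpose_sub, Matrix.transpose_smul, Matrix.transpose_one, Matrix.transpose_map]
  simp only [tfm, dual]
  rw [h]
  simp only [Matrix.transpose_add, Matrix.transpose_mul, Matrix.transpose_map,
    Matrix.transpose_nonsing_inv, Matrix.mul_assoc]

theorem IsMinimal.dual {R : Realization ι κ ο} (hR : R.IsMinimal) : R.dual.IsMinimal := by
  intro k R' h
  refine hR k R'.dual ?_
  rw [tfm_dual, h, tfm_dual, Matrix.transpose_transpose]

theorem IsMinimal.controllableAt [Fintype κ] {R : Realization ι κ ο} (hR : R.IsMinimal) (l : ℂ) :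
    ControllableAt R.A R.B l :=
  hR.dual.observableAt l

end Realization

/-! ### Asymptotic stability of linear systems from their eigenvalues -/

/-- A scalar stable linear recursion with vanishing forcing term has vanishing solutions. -/
theorem tendsto_zero_of_recursion {V : Type} [NormedAddCommGroup V] [NormedSpace ℂ V] {a : ℂ}
    (ha : ‖a‖ < 1) {c d : ℕ → V} (hc : ∀ t, c (t + 1) = a • c t + d t)
    (hd : Tendsto d atTop (𝓝 0)) : Tendsto c atTop (𝓝 0) := by
  rw [Metric.tendsto_atTop] at hd ⊢
  intro ε hε
  have h1 : 0 < 1 - ‖a‖ := sub_pos.2 ha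
  -- With this forcing bound, `ε / 2` is the fixed point of the scalar recursion `e ↦ ‖a‖ * e + ε /
  -- 2 * (1 - ‖a‖)`.
  obtain ⟨T, hT⟩ := hd (ε / 2 * (1 - ‖a‖)) (by positivity)
  have hbound : ∀ k, ‖c (T + k)‖ ≤ ‖a‖ ^ k * ‖c T‖ + ε / 2 := by
    intro k
    induction k with
    | zero =>
      rw [pow_zero, one_mul, add_zero]
      linarith
    | succ k ih =>
      have h2 := hT (T + k) (by omega)
      rw [dist_zero_right] at h2
      calc ‖c (T + (k + 1))‖ = ‖a • c (T + k) + d (T + k)‖ := by rw [← add_assoc, hc]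
        _ ≤ ‖a‖ * ‖c (T + k)‖ + ‖d (T + k)‖ := by
          rw [← norm_smul]; exact norm_add_le _ _
        _ ≤ ‖a‖ * (‖a‖ ^ k * ‖c T‖ + ε / 2) + ε / 2 * (1 - ‖a‖) := by gcongr
        _ = ‖a‖ ^ (k + 1) * ‖c T‖ + ε / 2 := by ring
  have hpow : Tendsto (fun k => ‖a‖ ^ k * ‖c T‖) atTop (𝓝 0) := by
    simpa using (tendsto_pow_atTop_nhds_zero_of_lt_one (norm_nonneg a) ha).mul_const ‖c T‖
  obtain ⟨k₀, hk₀⟩ := eventually_atTop.1 (hpow.eventually_lt_const (half_pos hε))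
  refine ⟨T + k₀, fun t ht => ?_⟩
  obtain ⟨k, rfl⟩ := Nat.exists_eq_add_of_le (show T ≤ t by omega)
  rw [dist_zero_right]
  linarith [hbound k, hk₀ k (by omega)]

/-- A scalar stable linear differential equation with vanishing forcing term has vanishing
solutions. -/
theorem tendsto_zero_of_hasDerivWithinAt {V : Type} [NormedAddCommGroup V] [NormedSpace ℂ V]
    [NormedSpace ℝ V] [IsScalarTower ℝ ℂ V] {a : ℂ}
    (ha : a.re < 0) {c d : ℝ → V}
    (hc : ∀ t, 0 ≤ t → HasDerivWithinAt c (a • c t + d t) (Set.Ici 0) t)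
    (hd : Tendsto d atTop (𝓝 0)) : Tendsto c atTop (𝓝 0) := by
  rw [Metric.tendsto_atTop] at hd ⊢
  intro ε hε
  set s := -a.re with hs
  have hs0 : 0 < s := neg_pos.2 ha
  -- Weighted by `exp (s * t)`, a forcing of this size integrates to at most `ε / 2 * exp (s * t)`.
  obtain ⟨T₀, hT₀⟩ := hd (ε / 2 * s) (by positivity)
  set T := max T₀ 0
  have hT0 : 0 ≤ T := le_max_right _ _
  -- Integrating factor: the derivative of `h` contains only the forcing term.
  set h : ℝ → V := fun t => Complex.exp (-a * t) • c t with hh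
  have hexp : ∀ t : ℝ, ‖Complex.exp (-a * t)‖ = Real.exp (s * t) := by
    intro t
    rw [Complex.norm_exp]
    simp [hs]
  have hderiv : ∀ t : ℝ, 0 ≤ t → HasDerivWithinAt h (Complex.exp (-a * t) • d t) (Set.Ici 0) t := by
    intro t ht
    have h1 : HasDerivAt (fun t : ℝ => Complex.exp (-a * t)) (Complex.exp (-a * t) * (-a)) t := by
      have h2 : HasDerivAt (fun t : ℝ => -a * (t : ℂ)) (-a) t := by
        simpa using (Complex.ofRealCLM.hasDerivAt (x := t)).const_mul (-a)
      exact h2.cexp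
    have h3 := h1.hasDerivWithinAt.smul (hc t ht)
    convert! h3 using 1
    rw [smul_add, smul_smul, mul_neg, neg_smul]
    abel
  have hbound : ∀ t : ℝ, T ≤ t → ‖h t‖ ≤ ‖h T‖ + ε / 2 * (Real.exp (s * t) - Real.exp (s * T)) := by
    intro t ht
    refine image_norm_le_of_norm_deriv_right_le_deriv_boundary (a := T) (b := t)
      (f' := fun t : ℝ => Complex.exp (-a * t) • d t)
      (B := fun t => ‖h T‖ + ε / 2 * (Real.exp (s * t) - Real.exp (s * T)))
      (B' := fun t => ε / 2 * (Real.exp (s * t) * s))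
      (fun x hx => ?_) (fun x hx => ?_) ?_ (fun x => ?_) (fun x hx => ?_) ⟨ht, le_rfl⟩
    · exact ((hderiv x (hT0.trans hx.1)).continuousWithinAt).mono
        fun y hy => hT0.trans hy.1
    · exact (hderiv x (hT0.trans hx.1)).mono fun y hy => (hT0.trans hx.1).trans hy
    · simp
    · have h2 : HasDerivAt (fun t : ℝ => s * t) s x := by
        simpa using (hasDerivAt_id x).const_mul s
      exact ((h2.exp.sub_const _).const_mul _).const_add _
    · have h2 := hT₀ x ((le_max_left _ _).trans hx.1)
      rw [dist_zero_right] at h2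
      rw [norm_smul, hexp]
      calc Real.exp (s * x) * ‖d x‖ ≤ Real.exp (s * x) * (ε / 2 * s) := by gcongr
        _ = ε / 2 * (Real.exp (s * x) * s) := by ring
  have hpow : Tendsto (fun t : ℝ => Real.exp (-(s * t)) * ‖h T‖) atTop (𝓝 0) := by
    have h1 : Tendsto (fun t : ℝ => s * t) atTop atTop := tendsto_id.const_mul_atTop hs0
    simpa using (Real.tendsto_exp_neg_atTop_nhds_zero.comp h1).mul_const ‖h T‖
  obtain ⟨t₀, ht₀⟩ := eventually_atTop.1 (hpow.eventually_lt_const (half_pos hε))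
  refine ⟨max T t₀, fun t ht => ?_⟩
  have h1 := hbound t ((le_max_left _ _).trans ht)
  have h2 := ht₀ t ((le_max_right _ _).trans ht)
  have h3 : ‖h t‖ = Real.exp (s * t) * ‖c t‖ := by rw [hh, norm_smul, hexp]
  have h4 : Real.exp (-(s * t)) * Real.exp (s * t) = 1 := by rw [← Real.exp_add]; simp
  rw [dist_zero_right]
  calc ‖c t‖ = Real.exp (-(s * t)) * ‖h t‖ := by rw [h3, ← mul_assoc, h4, one_mul]
    _ ≤ Real.exp (-(s * t)) * (‖h T‖ + ε / 2 * (Real.exp (s * t) - Real.exp (s * T))) := by gcongr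
    _ ≤ Real.exp (-(s * t)) * (‖h T‖ + ε / 2 * Real.exp (s * t)) := by
      gcongr
      linarith [Real.exp_pos (s * T)]
    _ = Real.exp (-(s * t)) * ‖h T‖ + ε / 2 := by
      rw [mul_add, mul_left_comm, h4, mul_one]
    _ < ε := by linarith

theorem HasSigma.map {E F : Type} [NormedAddCommGroup E] [NormedSpace ℝ E] [NormedAddCommGroup F]
    [NormedSpace ℝ F] (L : E →L[ℝ] F) {𝕋 : TimeDomain} {x : 𝕋.Time → E} {d : E} {t : 𝕋.Time}
    (h : HasSigma 𝕋 x d t) : HasSigma 𝕋 (fun s => L (x s)) (L d) t := by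
  cases 𝕋 with
  | continuous =>
    change ℝ → E at x
    change ℝ at t
    have h1 : HasDerivWithinAt x d (Set.Ici 0) t := h
    exact L.hasFDerivAt.comp_hasDerivWithinAt t h1
  | discrete => exact congrArg L h

/-- A scalar stable linear equation with vanishing forcing term has vanishing solutions. -/
theorem tendsto_zero_of_hasSigma_smul {V : Type} [NormedAddCommGroup V] [NormedSpace ℂ V]
    [NormedSpace ℝ V] [IsScalarTower ℝ ℂ V] {𝕋 : TimeDomain} {a : ℂ} (ha : a ∈ 𝕋.stabilityDomain)
    {c d : 𝕋.Time → V} (hc : ∀ t, 0 ≤ t → HasSigma 𝕋 c (a • c t + d t) t)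
    (hd : Tendsto d atTop (𝓝 0)) : Tendsto c atTop (𝓝 0) := by
  cases 𝕋 with
  | continuous => exact tendsto_zero_of_hasDerivWithinAt ha hc hd
  | discrete => exact tendsto_zero_of_recursion ha (fun t => hc t (Nat.zero_le t)) hd

/-- Peel off one root at a time: `(g - a) c` is again a trajectory, annihilated by the remaining
factors, so it tends to zero by induction. Then `c` solves a scalar stable equation with that
vanishing forcing. No Jordan form is needed. -/
theorem tendsto_zero_of_aeval_prod_eq_zero {d : ℕ} {𝕋 : TimeDomain}
    (g : Module.End ℂ (Fin d → ℂ)) (s : Multiset ℂ) (hs : ∀ a ∈ s, a ∈ 𝕋.stabilityDomain)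
    {c : 𝕋.Time → Fin d → ℂ} (hc : ∀ t, 0 ≤ t → HasSigma 𝕋 c (g (c t)) t)
    (h0 : ∀ t, Polynomial.aeval g (s.map fun a => Polynomial.X - Polynomial.C a).prod (c t) = 0) :
    Tendsto c atTop (𝓝 0) := by
  induction s using Multiset.induction_on generalizing c with
  | empty =>
    have : c = fun _ => 0 := funext fun t => by simpa using h0 t
    rw [this]
    exact tendsto_const_nhds
  | cons a s ih =>
    set L : Module.End ℂ (Fin d → ℂ) := g - algebraMap ℂ _ a with hL
    have hLa : Polynomial.aeval g (Polynomial.X - Polynomial.C a) = L := by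
      rw [map_sub, Polynomial.aeval_X, Polynomial.aeval_C]
    have hLv : ∀ v, L v = g v - a • v := fun v => by
      rw [hL, LinearMap.sub_apply, Module.algebraMap_end_apply]
    refine tendsto_zero_of_hasSigma_smul (d := fun t => L (c t)) (hs a (by simp)) (fun t ht => ?_) ?_
    · rw [hLv, add_sub_cancel]
      exact hc t ht
    · refine ih (fun b hb => hs b (by simp [hb])) (fun t ht => ?_) (fun t => ?_)
      · have h1 := (hc t ht).map (LinearMap.toContinuousLinearMap (L.restrictScalars ℝ))
        have h2 : g (L (c t)) = L (g (c t)) := by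
          simp only [hLv, map_sub, map_smul]
        rw [h2]
        exact h1
      · have h1 := h0 t
        rw [Multiset.map_cons, Multiset.prod_cons, mul_comm, map_mul, hLa] at h1
        exact h1

/-- The complex number `l` is not an eigenvalue of the real linear map `f`: the only `a + i b` with
`f (a + i b) = l (a + i b)` is zero. -/
def NotEigenvalue {E : Type} [AddCommGroup E] [Module ℝ E] (f : E →ₗ[ℝ] E) (l : ℂ) : Prop :=
  ∀ a b : E, f a = l.re • a - l.im • b → f b = l.re • b + l.im • a → a = 0 ∧ b = 0

section

variable {E : Type} [NormedAddCommGroup E] [NormedSpace ℝ E] [FiniteDimensional ℝ E]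
  {𝕋 : TimeDomain} (f : E →ₗ[ℝ] E)

/-- Complexify in a basis. By Cayley–Hamilton the product of `g - l` over the roots of the
characteristic polynomial vanishes, and a root outside the stability domain would have an
eigenvector whose real and imaginary parts contradict `hf`. -/
theorem tendsto_zero_of_hasSigma (hf : ∀ l ∉ 𝕋.stabilityDomain, NotEigenvalue f l)
    {X : 𝕋.Time → E} (hX : ∀ t, 0 ≤ t → HasSigma 𝕋 X (f (X t)) t) : Tendsto X atTop (𝓝 0) := by
  set b := Module.finBasis ℝ E
  set M := LinearMap.toMatrix b b f
  set g : Module.End ℂ (Fin (Module.finrank ℝ E) → ℂ) := Matrix.toLin' (cplx M) with hg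
  have hgv : ∀ v, g v = cplx M *ᵥ v := fun v => Matrix.toLin'_apply _ v
  have hMf : ∀ x, M *ᵥ (b.equivFun x) = b.equivFun (f x) := fun x => LinearMap.toMatrix_mulVec_repr b b f x
  set J : E →ₗ[ℝ] (Fin (Module.finrank ℝ E) → ℂ) :=
    LinearMap.pi fun i => Complex.ofRealLI.toLinearMap ∘ₗ b.coord i with hJ
  have hJx : ∀ x i, J x i = (b.equivFun x i : ℂ) := fun x i => rfl
  have hgJ : ∀ x, J (f x) = g (J x) := by
    intro x
    funext i
    rw [hJx, hgv, ← hMf]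
    simp [Matrix.mulVec, dotProduct, hJx]
  have hroots : ∀ l ∈ g.charpoly.roots, l ∈ 𝕋.stabilityDomain := by
    intro l hl
    by_contra hlS
    have hev : g.HasEigenvalue l := by
      rw [Module.End.hasEigenvalue_iff_isRoot_charpoly]
      exact Polynomial.isRoot_of_mem_roots hl
    obtain ⟨v, hv⟩ := hev.exists_hasEigenvector
    have hgl := hv.apply_eq_smul
    rw [hgv] at hgl
    set x := b.equivFun.symm fun i => (v i).re with hx
    set y := b.equivFun.symm fun i => (v i).im with hy
    have hrx : b.equivFun x = fun i => (v i).re := b.equivFun.apply_symm_apply _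
    have hry : b.equivFun y = fun i => (v i).im := b.equivFun.apply_symm_apply _
    obtain ⟨hx0, hy0⟩ := hf l hlS x y (by
        apply b.equivFun.injective
        rw [map_sub, map_smul, map_smul, hrx, hry]
        rw [← hMf, hrx]
        funext i
        rw [← re_cplx_mulVec, hgl]
        simp) (by
        apply b.equivFun.injective
        rw [map_add, map_smul, map_smul, hrx, hry]
        rw [← hMf, hry]
        funext i
        rw [← im_cplx_mulVec, hgl]
        simp)
    rw [hx0, map_zero] at hrx
    rw [hy0, map_zero] at hry
    exact hv.2 (funext fun i => Complex.ext (congrFun hrx i).symm (congrFun hry i).symm)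
  have hJX : Tendsto (fun t => J (X t)) atTop (𝓝 0) := by
    refine tendsto_zero_of_aeval_prod_eq_zero g g.charpoly.roots hroots (fun t ht => ?_)
      (fun t => ?_)
    · have h1 := (hX t ht).map (LinearMap.toContinuousLinearMap J)
      rw [← hgJ]
      exact h1
    · rw [← (IsAlgClosed.splits g.charpoly).eq_prod_roots_of_monic g.charpoly_monic,
        LinearMap.aeval_self_charpoly, LinearMap.zero_apply]
  have hre : Tendsto (fun t => b.equivFun (X t)) atTop (𝓝 0) := by
    refine tendsto_pi_nhds.2 fun i => ?_
    have h1 := (Complex.continuous_re.tendsto 0).comp (tendsto_pi_nhds.1 hJX i)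
    exact h1
  have h2 := (LinearMap.continuous_of_finiteDimensional b.equivFun.symm.toLinearMap).tendsto 0
  have h3 := h2.comp hre
  simpa [Function.comp_def] using h3

/-- The flow of a linear system. -/
theorem exists_flow (𝕋 : TimeDomain) :
    ∃ Φ : 𝕋.Time → E →L[ℝ] E,
      (∀ x, (∀ t, 0 ≤ t → HasSigma 𝕋 (fun s => Φ s x) (f (Φ t x)) t) ∧ Φ 0 x = x) ∧
      (∀ X : 𝕋.Time → E, (∀ t, 0 ≤ t → HasSigma 𝕋 X (f (X t)) t) →
        ∀ t, 0 ≤ t → X t = Φ t (X 0)) ∧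
      ∀ x, Tendsto (fun t => Φ t x) atTop (𝓝 0) → ∃ C, ∀ t, 0 ≤ t → ‖Φ t x‖ ≤ C := by
  have : CompleteSpace E := FiniteDimensional.complete ℝ E
  set F : E →L[ℝ] E := LinearMap.toContinuousLinearMap f with hF
  cases 𝕋 with
  | continuous =>
    set Φ : ℝ → E →L[ℝ] E := fun t => NormedSpace.exp (t • F) with hΦ
    have hΦd : ∀ x (t : ℝ), HasDerivAt (fun s : ℝ => Φ s x) (f (Φ t x)) t := by
      intro x t
      have h1 := hasDerivAt_exp_smul_const' (𝕂 := ℝ) F t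
      have h2 := (ContinuousLinearMap.apply ℝ E x).hasFDerivAt.comp_hasDerivAt t h1
      exact h2
    have hΦ0 : ∀ x, Φ 0 x = x := fun x => by simp [hΦ]
    have hΦw : ∀ x (t : ℝ), 0 ≤ t →
        HasDerivWithinAt (fun s : ℝ => Φ s x) (f (Φ t x)) (Set.Ici 0) t :=
      fun x t _ => (hΦd x t).hasDerivWithinAt
    refine ⟨Φ, fun x => ⟨hΦw x, hΦ0 x⟩, ?_, ?_⟩
    · intro X hX t ht
      change ℝ → E at X
      change ℝ at t
      change (0 : ℝ) ≤ t at ht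
      have hX' : ∀ s : ℝ, 0 ≤ s → HasDerivWithinAt X (F (X s)) (Set.Ici 0) s := hX
      refine ODE_solution_unique (v := fun _ x => F x) (K := ‖F‖₊) (f := X)
        (g := fun s => Φ s (X (0 : ℝ))) (a := 0) (b := t) (fun _ => F.lipschitz) ?_ ?_ ?_ ?_ ?_
        ⟨ht, le_rfl⟩
      · exact fun s hs => (hX' s hs.1).continuousWithinAt.mono fun r hr => hr.1
      · exact fun s hs => (hX' s hs.1).mono fun r hr => hs.1.trans hr
      · exact fun s _ => (hΦd _ s).continuousAt.continuousWithinAt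
      · exact fun s _ => (hΦd _ s).hasDerivWithinAt
      · exact (hΦ0 _).symm
    · intro x hx
      have hx' : Tendsto (fun t : ℝ => Φ t x) atTop (𝓝 0) := hx
      have hcont : Continuous fun t : ℝ => Φ t x :=
        continuous_iff_continuousAt.2 fun t => (hΦd x t).continuousAt
      obtain ⟨T, hT⟩ := eventually_atTop.1 (hx'.norm.eventually_lt_const
        (show ‖(0 : E)‖ < 1 by simp))
      obtain ⟨C, hC⟩ := (isCompact_Icc (a := (0 : ℝ)) (b := T)).exists_bound_of_continuousOn
        hcont.continuousOn
      refine ⟨max C 1, fun (t : ℝ) ht => ?_⟩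
      rcases le_total t T with h | h
      · exact (hC t ⟨ht, h⟩).trans (le_max_left _ _)
      · exact (hT t h).le.trans (le_max_right _ _)
  | discrete =>
    set Φ : ℕ → E →L[ℝ] E := fun t => F ^ t with hΦ
    have hΦs : ∀ (t : ℕ) x, Φ (t + 1) x = f (Φ t x) := by
      intro t x
      simp only [hΦ, pow_succ', mul_apply_eq_comp]
      rfl
    refine ⟨Φ, fun x => ⟨fun t _ => hΦs t x, rfl⟩, ?_, ?_⟩
    · intro X hX t ht
      change ℕ at t
      have hX' : ∀ s : ℕ, X (s + 1 : ℕ) = f (X s) := fun s => hX s (Nat.zero_le s)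
      change X t = Φ t (X (0 : ℕ))
      clear ht
      induction t with
      | zero => rfl
      | succ t ih => rw [hX', ih, hΦs]
    · intro x hx
      have hx' : Tendsto (fun t : ℕ => Φ t x) atTop (𝓝 0) := hx
      obtain ⟨C, hC⟩ := hx'.norm.bddAbove_range
      exact ⟨C, fun t _ => hC ⟨t, rfl⟩⟩

/-- A linear system without eigenvalues outside of the stability domain is asymptotically stable. -/
theorem asymptoticallyStable_of_notEigenvalue
    (hf : ∀ l ∉ 𝕋.stabilityDomain, NotEigenvalue f l) :
    (∀ x, ∃ X : 𝕋.Time → E, (∀ t, 0 ≤ t → HasSigma 𝕋 X (f (X t)) t) ∧ X 0 = x) ∧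
    (∀ ε : ℝ, 0 < ε → ∃ η : ℝ, 0 < η ∧ ∀ X : 𝕋.Time → E,
      (∀ t, 0 ≤ t → HasSigma 𝕋 X (f (X t)) t) → ‖X 0‖ < η → ∀ t, 0 ≤ t → ‖X t‖ < ε) ∧
    (∀ X : 𝕋.Time → E, (∀ t, 0 ≤ t → HasSigma 𝕋 X (f (X t)) t) → Tendsto X atTop (𝓝 0)) := by
  obtain ⟨Φ, h1, h2, h3⟩ := exists_flow f 𝕋
  refine ⟨fun x => ⟨fun t => Φ t x, h1 x⟩, fun ε hε => ?_, fun X hX =>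
    tendsto_zero_of_hasSigma f hf hX⟩
  have : CompleteSpace E := FiniteDimensional.complete ℝ E
  -- Convergence bounds each orbit on `0 ≤ t`; uniform boundedness makes the bound uniform, which is
  -- Lyapunov stability. Negative times must be excluded, since backward orbits may grow.
  obtain ⟨C, hC⟩ := banach_steinhaus (g := fun t : {t : 𝕋.Time // 0 ≤ t} => Φ t) fun x => by
    obtain ⟨C, hC⟩ := h3 x (tendsto_zero_of_hasSigma f hf (h1 x).1)
    exact ⟨C, fun t => hC t t.2⟩
  have hC1 : 0 < |C| + 1 := by positivity
  refine ⟨ε / (|C| + 1), by positivity, fun X hX hX0 t ht => ?_⟩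
  rw [h2 X hX t ht]
  calc ‖Φ t (X 0)‖ ≤ (|C| + 1) * ‖X 0‖ := by
        refine (Φ t).le_of_opNorm_le ?_ _
        linarith [hC ⟨t, ht⟩, le_abs_self C]
    _ < ε := by rwa [lt_div_iff₀' hC1] at hX0

end

/-! ### Complexification of real matrices and vectors -/

theorem cplx_mul {ο κ μ : Type} [Fintype κ] (M : Matrix ο κ ℝ) (N : Matrix κ μ ℝ) :
    cplx (M * N) = cplx M * cplx N :=
  Matrix.map_mul (f := Complex.ofRealHom)

theorem cplx_add {ο κ : Type} (M N : Matrix ο κ ℝ) : cplx (M + N) = cplx M + cplx N :=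
  Matrix.map_add _ Complex.ofReal_add M N

theorem cplx_sub {ο κ : Type} (M N : Matrix ο κ ℝ) : cplx (M - N) = cplx M - cplx N :=
  Matrix.map_sub _ Complex.ofReal_sub M N

theorem cplx_one {ι : Type} [DecidableEq ι] : cplx (1 : Matrix ι ι ℝ) = 1 :=
  Matrix.map_one _ Complex.ofReal_zero Complex.ofReal_one

theorem cplx_zero {ο κ : Type} : cplx (0 : Matrix ο κ ℝ) = 0 :=
  Matrix.map_zero _ Complex.ofReal_zero

theorem cplx_fromCols {ο κ κ' : Type} (M : Matrix ο κ ℝ) (N : Matrix ο κ' ℝ) :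
    cplx (Matrix.fromCols M N) = Matrix.fromCols (cplx M) (cplx N) := by
  ext i (j | j) <;> rfl

theorem cplx_fromRows {ο ο' κ : Type} (M : Matrix ο κ ℝ) (N : Matrix ο' κ ℝ) :
    cplx (Matrix.fromRows M N) = Matrix.fromRows (cplx M) (cplx N) := by
  ext (i | i) j <;> rfl

/-- The complex vector with given real and imaginary parts. -/
def complexVec {ι : Type} (a b : ι → ℝ) : ι → ℂ := fun j => ⟨a j, b j⟩

theorem cplx_mulVec_complexVec {ο κ : Type} [Fintype κ] (M : Matrix ο κ ℝ) (a b : κ → ℝ) :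
    cplx M *ᵥ complexVec a b = complexVec (M *ᵥ a) (M *ᵥ b) := by
  funext i
  exact Complex.ext (re_cplx_mulVec M _ i) (im_cplx_mulVec M _ i)

theorem complexVec_add {ι : Type} (a b a' b' : ι → ℝ) :
    complexVec a b + complexVec a' b' = complexVec (a + a') (b + b') := rfl

theorem complexVec_smul {ι : Type} (l : ℂ) (a b : ι → ℝ) :
    l • complexVec a b = complexVec (l.re • a - l.im • b) (l.re • b + l.im • a) := by
  funext i
  refine Complex.ext ?_ ?_ <;> simp [complexVec]

theorem complexVec_sumElim {ι κ : Type} (a b : ι → ℝ) (a' b' : κ → ℝ) :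
    Sum.elim (complexVec a b) (complexVec a' b') =
      complexVec (Sum.elim a a') (Sum.elim b b') := by
  funext i
  rcases i with i | i <;> rfl

theorem complexVec_eq_zero {ι : Type} {a b : ι → ℝ} (h : complexVec a b = 0) : a = 0 ∧ b = 0 :=
  ⟨funext fun i => congrArg Complex.re (congrFun h i),
    funext fun i => congrArg Complex.im (congrFun h i)⟩

/-! ### Internal stability excludes common limiting pairs -/

section StabilizingController

variable {m p : ℕ} {𝕋 : TimeDomain} {K : TFM (Fin p) (Fin m)} {G : TFM (Fin m) (Fin p)}

/-- Under internal stability, the plant and the controller share no nonzero limiting input-output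
pair outside of the stability domain. -/
theorem IsStabilizingController.eq_zero_of_tendsto (hK : IsStabilizingController 𝕋 K G) {l : ℂ}
    (hl : l ∉ 𝕋.stabilityDomain) {u₀ : Fin p → ℂ} {y₀ : Fin m → ℂ} {v u : ℂ → Fin p → ℂ}
    {y z : ℂ → Fin m → ℂ} (hv : Tendsto v (𝓝[≠] l) (𝓝 u₀)) (hy : Tendsto y (𝓝[≠] l) (𝓝 y₀))
    (hvy : ∀ᶠ s in 𝓝[≠] l, y s = evalM G s *ᵥ v s)
    (hz : Tendsto z (𝓝[≠] l) (𝓝 y₀)) (hu : Tendsto u (𝓝[≠] l) (𝓝 u₀))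
    (hzu : ∀ᶠ s in 𝓝[≠] l, u s = evalM K s *ᵥ z s) : u₀ = 0 ∧ y₀ = 0 := by
  obtain ⟨T, hT, hTs⟩ := hK
  set N : TFM (Fin m ⊕ (Fin p ⊕ Fin m)) (Fin m ⊕ Fin p) :=
    Matrix.fromRows (Matrix.fromCols 1 (-G)) (Matrix.fromRows (Matrix.fromCols (-K) 1) 0) with hN
  -- Any `(z, v)` are loop signals for `r = z - G v`, `w = v - K z`, `ζ = 0`, and `N` computes these
  -- exogenous signals. So the `(z, v)` rows of `T` form a left inverse of `N`.
  have hTN : T.toRows₂ * N = 1 := by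
    refine Matrix.ext_of_mulVec_single fun j => ?_
    generalize (Pi.single j 1 : Fin m ⊕ Fin p → RatFunc ℝ) = s
    obtain ⟨z, v, rfl⟩ : ∃ z v, s = Sum.elim z v := ⟨_, _, (Sum.elim_comp_inl_inr s).symm⟩
    have h1 := (hT (z - G *ᵥ v) (v - K *ᵥ z) 0 (G *ᵥ v) (K *ᵥ z) z v).1
      ⟨by abel, rfl, by abel, by rw [add_zero]⟩
    have h2 : N *ᵥ Sum.elim z v = Sum.elim (z - G *ᵥ v) (Sum.elim (v - K *ᵥ z) 0) := by
      simp only [hN, Matrix.fromRows_mulVec, Matrix.fromCols_mulVec_sumElim, Matrix.one_mulVec,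
        Matrix.neg_mulVec, Matrix.zero_mulVec]
      congr 2 <;> abel
    rw [← Matrix.mulVec_mulVec, h2, Matrix.one_mulVec]
    funext i
    exact (congrFun h1 (Sum.inr i)).symm
  have hev : ∀ᶠ s in 𝓝[≠] l, Sum.elim (z s) (v s) =
      evalM T.toRows₂ s *ᵥ Sum.elim (z s - y s) (Sum.elim (v s - u s) 0) := by
    have hcof := nhdsNE_le_cofinite l
    filter_upwards [(evalM_mul T.toRows₂ N).filter_mono hcof, (evalM_neg G).filter_mono hcof,
      (evalM_neg K).filter_mono hcof, hvy, hzu] with s h1 h2 h3 h4 h5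
    have h6 : evalM N s = Matrix.fromRows (Matrix.fromCols 1 (-evalM G s))
        (Matrix.fromRows (Matrix.fromCols (-evalM K s) 1) 0) := by
      rw [← h2, ← h3, ← evalM_one, ← evalM_one, ← evalM_zero s]
      ext (i | i | i) (j | j) <;> rfl
    have h7 : evalM N s *ᵥ Sum.elim (z s) (v s) =
        Sum.elim (z s - y s) (Sum.elim (v s - u s) 0) := by
      rw [h6, h4, h5]
      simp only [Matrix.fromRows_mulVec, Matrix.fromCols_mulVec_sumElim, Matrix.one_mulVec,
        Matrix.neg_mulVec, Matrix.zero_mulVec]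
      congr 2
      abel
    rw [← h7, Matrix.mulVec_mulVec, ← h1, hTN, evalM_one, Matrix.one_mulVec]
  have hTl : ContinuousAt (evalM T.toRows₂) l :=
    IsStableTFM.continuousAt_evalM (fun i j => hTs (Sum.inr i) j) hl
  -- The pairs of plant and controller have the same limits, so the mismatches vanish at `l`, and
  -- `T` stays bounded there.
  have hrhs : Tendsto (fun s => Sum.elim (z s - y s) (Sum.elim (v s - u s) 0)) (𝓝[≠] l)
      (𝓝 (0 : Fin m ⊕ (Fin p ⊕ Fin m) → ℂ)) := by
    have h1 := hz.sub hy
    have h2 := hv.sub hu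
    rw [sub_self] at h1 h2
    refine tendsto_pi_nhds.2 fun i => ?_
    rcases i with i | i | i
    · exact tendsto_pi_nhds.1 h1 i
    · exact tendsto_pi_nhds.1 h2 i
    · exact tendsto_const_nhds
  have hlim := tendsto_mulVec (hTl.tendsto.mono_left nhdsWithin_le_nhds) hrhs
  rw [Matrix.mulVec_zero] at hlim
  have hlim' := hlim.congr' (hev.mono fun s hs => hs.symm)
  refine ⟨funext fun i => ?_, funext fun i => ?_⟩
  · exact tendsto_nhds_unique (tendsto_pi_nhds.1 hv i) (tendsto_pi_nhds.1 hlim' (Sum.inr i))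
  · exact tendsto_nhds_unique (tendsto_pi_nhds.1 hz i) (tendsto_pi_nhds.1 hlim' (Sum.inl i))

end StabilizingController

/-! ### The implementation `K_d` and the SRTR realization -/

section Implementation

variable {m p q : ℕ} {𝕋 : TimeDomain} {W : TFM (Fin p) (Fin p)} {V : TFM (Fin p) (Fin m)} {k : ℕ}
  {Q : Realization (Fin k) (Fin p ⊕ Fin m) (Fin 1)} {i : Fin p}

theorem IsStableTFM.fromCols {ο κ κ' : Type} {G : TFM ο κ} {H : TFM ο κ'} (hG : IsStableTFM 𝕋 G)
    (hH : IsStableTFM 𝕋 H) : IsStableTFM 𝕋 (Matrix.fromCols G H) := by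
  intro i j
  rcases j with j | j
  · exact hG i j
  · exact hH i j

/-- Clearing the factor `λ⁻¹` leaves only `[W V]`, which is regular at every point outside the
stability domain, including `0` in continuous time. -/
theorem eventually_evalM_row (hQ : Q.tfm = Matrix.replicateRow (Fin 1) (srtrImplementation W V i)) :
    ∀ᶠ z : ℂ in cofinite, ∀ s, z * (evalM Q.tfm z *ᵥ s) 0 =
      (evalM (Matrix.fromCols W V) z *ᵥ s) i := by
  have h1 : ∀ j, RatFunc.X * Q.tfm 0 j = Matrix.fromCols W V i j := by
    intro j
    rw [hQ]
    rcases j with j | j <;>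
      simp [srtrImplementation, mul_inv_cancel_left₀ (RatFunc.X_ne_zero (K := ℝ))]
  have h2 : ∀ᶠ z : ℂ in cofinite, ∀ j,
      evalC (RatFunc.X * Q.tfm 0 j) z = evalC RatFunc.X z * evalC (Q.tfm 0 j) z :=
    eventually_all.2 fun j => evalC_mul _ _
  filter_upwards [h2] with z hz s
  simp only [Matrix.mulVec, dotProduct, Finset.mul_sum]
  refine Finset.sum_congr rfl fun j _ => ?_
  have h3 := hz j
  rw [h1, evalC_X] at h3
  rw [← mul_assoc]
  exact congrArg (· * s j) h3.symm

/-- A realization of a row of the implementation of an SRTR pair has no feedthrough. -/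
theorem feedthrough_eq_zero {S : Realization (Fin q) (Fin p ⊕ Fin m) (Fin p)}
    (hS : Matrix.fromCols W V = S.tfm)
    (hQ : Q.tfm = Matrix.replicateRow (Fin 1) (srtrImplementation W V i)) : Q.D = 0 := by
  have hcof : Bornology.cobounded ℂ ≤ cofinite :=
    Metric.cobounded_le_cocompact.trans cocompact_le_cofinite
  ext a j
  obtain rfl := Subsingleton.elim a 0
  set s : Fin p ⊕ Fin m → ℂ := Pi.single j 1
  have h1 := tendsto_pi_nhds.1 (Q.tendsto_evalM_tfm_mulVec s) 0
  have h2 := tendsto_pi_nhds.1 (S.tendsto_evalM_tfm_mulVec s) i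
  have h3 := (tendsto_inv₀_cobounded (α := ℂ)).mul h2
  rw [zero_mul] at h3
  have h4 : Tendsto (fun z => (evalM Q.tfm z *ᵥ s) 0) (Bornology.cobounded ℂ) (𝓝 0) := by
    refine h3.congr' ?_
    filter_upwards [(eventually_evalM_row hQ).filter_mono hcof,
      hcof (show ∀ᶠ z : ℂ in cofinite, z ≠ 0 from eventually_cofinite_ne 0)] with z hz h0
    rw [← hS, ← hz s, inv_mul_cancel_left₀ h0]
  have h5 := tendsto_nhds_unique h1 h4
  rw [Matrix.mulVec_single_one] at h5
  exact Complex.ofReal_eq_zero.1 h5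

/-- The limiting input-output pairs of the rows of the implementation satisfy `l u = W u + V z`. -/
theorem mul_command_eq {l : ℂ} (hl : l ∉ 𝕋.stabilityDomain) (hW : IsStableTFM 𝕋 W)
    (hV : IsStableTFM 𝕋 V)
    (hQ : Q.tfm = Matrix.replicateRow (Fin 1) (srtrImplementation W V i))
    (hc : ControllableAt Q.A Q.B l) {ξ : Fin k → ℂ} {s₀ : Fin p ⊕ Fin m → ℂ}
    (h : (cplx Q.A - l • 1) *ᵥ ξ + cplx Q.B *ᵥ s₀ = 0) :
    l * (cplx Q.C *ᵥ ξ + cplx Q.D *ᵥ s₀) 0 = (evalM (Matrix.fromCols W V) l *ᵥ s₀) i := by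
  obtain ⟨s, y, hs, hy, hsy⟩ := Q.exists_tendsto_of_controllableAt hc h
  have h1 := (tendsto_id.mono_left (nhdsWithin_le_nhds (s := {l}ᶜ))).mul (tendsto_pi_nhds.1 hy 0)
  have h2 := tendsto_mulVec
    (((hW.fromCols hV).continuousAt_evalM hl).tendsto.mono_left nhdsWithin_le_nhds) hs
  refine tendsto_nhds_unique (h1.congr' ?_) (tendsto_pi_nhds.1 h2 i)
  filter_upwards [hsy, (eventually_evalM_row hQ).filter_mono (nhdsNE_le_cofinite l)] with z h3 h4
  rw [h3]
  exact h4 _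

variable {A₁₁ : Matrix (Fin p) (Fin p) ℝ} {A₁₂ : Matrix (Fin p) (Fin q) ℝ}
  {A₂₁ : Matrix (Fin q) (Fin p) ℝ} {A₂₂ : Matrix (Fin q) (Fin q) ℝ}
  {B₁ : Matrix (Fin p) (Fin m) ℝ} {B₂ : Matrix (Fin q) (Fin m) ℝ} {L : Matrix (Fin q) (Fin p) ℝ}

/-- The term `L * A₁₂` is an output injection, invisible to `β` with `A₁₂ β = 0`. An unobservable
eigenvector `β` thus extends by zero to one of the controller's realization, whose output reads only
the first block. -/
theorem observableAt_srtrRealization {l : ℂ}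
    (h : ObservableAt (outputFirst A₁₁ A₁₂ A₂₁ A₂₂ B₁ B₂).C (outputFirst A₁₁ A₁₂ A₂₁ A₂₂ B₁ B₂).A l) :
    ObservableAt (srtrRealization A₁₁ A₁₂ A₂₁ A₂₂ B₁ B₂ L).C
      (srtrRealization A₁₁ A₁₂ A₂₁ A₂₂ B₁ B₂ L).A l := by
  refine observableAt_of_mulVec fun β h1 h2 => ?_
  change cplx A₁₂ *ᵥ β = 0 at h2
  change cplx (A₂₂ + L * A₁₂) *ᵥ β = l • β at h1
  rw [cplx_add, cplx_mul, Matrix.add_mulVec, ← Matrix.mulVec_mulVec, h2, Matrix.mulVec_zero,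
    add_zero] at h1
  have h3 := h.eq_zero (x := Sum.elim 0 β) ?_ ?_
  · exact funext fun j => congrFun h3 (Sum.inr j)
  · simp only [outputFirst, Matrix.sub_mulVec, Matrix.smul_mulVec, Matrix.one_mulVec, cplx,
      Matrix.fromBlocks_map, Matrix.fromBlocks_mulVec, Sum.elim_comp_inl, Sum.elim_comp_inr,
      Matrix.mulVec_zero, zero_add]
    change cplx A₂₂ *ᵥ β = l • β at h1
    rw [show A₁₂.map _ *ᵥ β = 0 from h2, show A₂₂.map _ *ᵥ β = l • β from h1]
    funext j
    rcases j with j | j <;> simp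
  · simp only [outputFirst, cplx_fromCols, cplx_zero, Matrix.fromCols_mulVec_sumElim,
      Matrix.mulVec_zero, Matrix.zero_mulVec, add_zero]

/-- A solution of the pencil equations of the SRTR realization with output `l u` gives one of the
pencil equations of the controller's realization. -/
theorem exists_state_outputFirst {l : ℂ} {β : Fin q → ℂ} {u₀ : Fin p → ℂ} {z₀ : Fin m → ℂ}
    (h1 : (cplx (srtrRealization A₁₁ A₁₂ A₂₁ A₂₂ B₁ B₂ L).A - l • 1) *ᵥ β +
      cplx (srtrRealization A₁₁ A₁₂ A₂₁ A₂₂ B₁ B₂ L).B *ᵥ Sum.elim u₀ z₀ = 0)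
    (h2 : cplx (srtrRealization A₁₁ A₁₂ A₂₁ A₂₂ B₁ B₂ L).C *ᵥ β +
      cplx (srtrRealization A₁₁ A₁₂ A₂₁ A₂₂ B₁ B₂ L).D *ᵥ Sum.elim u₀ z₀ = l • u₀) :
    ∃ x : Fin p ⊕ Fin q → ℂ, (cplx (outputFirst A₁₁ A₁₂ A₂₁ A₂₂ B₁ B₂).A - l • 1) *ᵥ x +
        cplx (outputFirst A₁₁ A₁₂ A₂₁ A₂₂ B₁ B₂).B *ᵥ z₀ = 0 ∧
      cplx (outputFirst A₁₁ A₁₂ A₂₁ A₂₂ B₁ B₂).C *ᵥ x +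
        cplx (outputFirst A₁₁ A₁₂ A₂₁ A₂₂ B₁ B₂).D *ᵥ z₀ = u₀ := by
  simp only [srtrRealization, cplx_fromCols, cplx_add, cplx_sub, cplx_mul,
    Matrix.fromCols_mulVec_sumElim, Matrix.add_mulVec, Matrix.sub_mulVec, Matrix.smul_mulVec,
    Matrix.one_mulVec, ← Matrix.mulVec_mulVec] at h1 h2
  have h3 := congrArg (cplx L *ᵥ ·) h2
  simp only [Matrix.mulVec_add, Matrix.mulVec_sub, Matrix.mulVec_smul] at h3
  -- The SRTR state is the second block plus `L` times the output; this undoes that change of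
  -- variables.
  refine ⟨Sum.elim u₀ (β - cplx L *ᵥ u₀), ?_, ?_⟩
  · have hA : cplx (Matrix.fromBlocks A₁₁ A₁₂ A₂₁ A₂₂) =
        Matrix.fromBlocks (cplx A₁₁) (cplx A₁₂) (cplx A₂₁) (cplx A₂₂) := Matrix.fromBlocks_map ..
    simp only [outputFirst, hA, cplx_fromRows, Matrix.sub_mulVec, Matrix.smul_mulVec,
      Matrix.one_mulVec, Matrix.fromBlocks_mulVec, Sum.elim_comp_inl, Sum.elim_comp_inr,
      Matrix.fromRows_mulVec, Matrix.mulVec_sub]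
    funext j
    rcases j with j | j
    · have h4 := congrFun h2 j
      simp only [Pi.add_apply, Pi.sub_apply, Pi.smul_apply, smul_eq_mul, Pi.zero_apply,
        Sum.elim_inl] at h4 ⊢
      linear_combination h4
    · have h4 := congrFun h1 j
      have h5 := congrFun h3 j
      simp only [Pi.add_apply, Pi.sub_apply, Pi.smul_apply, smul_eq_mul, Pi.zero_apply,
        Sum.elim_inr] at h4 h5 ⊢
      -- The second block row is the SRTR state equation minus `L` times its output equation.
      linear_combination h4 - h5
  · simp only [outputFirst, cplx_fromCols, cplx_one, cplx_zero, Matrix.fromCols_mulVec_sumElim,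
      Matrix.one_mulVec, Matrix.zero_mulVec, add_zero]

end Implementation

/-! ### The closed loop as a linear system -/

section ClosedLoop

variable {m p n : ℕ} {k : Fin p → ℕ} (plant : Realization (Fin n) (Fin p) (Fin m))
  (R : (i : Fin p) → Realization (Fin (k i)) (Fin p ⊕ Fin m) (Fin 1))

/-- The command computed from the closed-loop state, without feedthrough in the subsystems. -/
def command : ClosedLoopState n k →ₗ[ℝ] (Fin p → ℝ) :=
  LinearMap.pi fun i => LinearMap.proj 0 ∘ₗ (R i).C.mulVecLin ∘ₗ LinearMap.proj i ∘ₗ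
    LinearMap.snd ℝ _ _

/-- The measurement determined by the closed-loop state. -/
def measurement : ClosedLoopState n k →ₗ[ℝ] (Fin m → ℝ) :=
  plant.C.mulVecLin ∘ₗ LinearMap.fst ℝ _ _ + plant.D.mulVecLin ∘ₗ command R

/-- The inputs of the controller's subsystems, as a function of the closed-loop state. -/
def subsystemInput : ClosedLoopState n k →ₗ[ℝ] (Fin p ⊕ Fin m → ℝ) :=
  LinearMap.pi (Sum.rec (fun i => LinearMap.proj i ∘ₗ command R)
    fun i => LinearMap.proj i ∘ₗ measurement plant R)

/-- The linear map that governs the autonomous closed loop. -/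
def closedLoopMap : ClosedLoopState n k →ₗ[ℝ] ClosedLoopState n k :=
  (plant.A.mulVecLin ∘ₗ LinearMap.fst ℝ _ _ + plant.B.mulVecLin ∘ₗ command R).prod
    (LinearMap.pi fun i => (R i).A.mulVecLin ∘ₗ LinearMap.proj i ∘ₗ LinearMap.snd ℝ _ _ +
      (R i).B.mulVecLin ∘ₗ subsystemInput plant R)

theorem command_apply (X : ClosedLoopState n k) (i : Fin p) :
    command R X i = ((R i).C *ᵥ X.2 i) 0 := rfl

theorem measurement_apply (X : ClosedLoopState n k) :
    measurement plant R X = plant.C *ᵥ X.1 + plant.D *ᵥ command R X := rfl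

theorem subsystemInput_apply (X : ClosedLoopState n k) :
    subsystemInput plant R X = Sum.elim (command R X) (measurement plant R X) := by
  funext i
  rcases i with i | i <;> rfl

theorem closedLoopMap_fst (X : ClosedLoopState n k) :
    (closedLoopMap plant R X).1 = plant.A *ᵥ X.1 + plant.B *ᵥ command R X := rfl

theorem closedLoopMap_snd (X : ClosedLoopState n k) (i : Fin p) :
    (closedLoopMap plant R X).2 i = (R i).A *ᵥ X.2 i +
      (R i).B *ᵥ Sum.elim (command R X) (measurement plant R X) := by
  rw [← subsystemInput_apply]
  rfl

theorem hasSigma_closedLoopState_iff {𝕋 : TimeDomain} {X : 𝕋.Time → ClosedLoopState n k}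
    {d : ClosedLoopState n k} {t : 𝕋.Time} :
    HasSigma 𝕋 X d t ↔ HasSigma 𝕋 (fun s => (X s).1) d.1 t ∧
      ∀ i, HasSigma 𝕋 (fun s => (X s).2 i) (d.2 i) t := by
  constructor
  · intro h
    refine ⟨h.map (ContinuousLinearMap.fst ℝ _ _), fun i => ?_⟩
    exact h.map (F := Fin (k i) → ℝ)
      (ContinuousLinearMap.proj (R := ℝ) (φ := fun i => Fin (k i) → ℝ) i ∘L
        ContinuousLinearMap.snd ℝ _ _)
  · rintro ⟨h1, h2⟩
    cases 𝕋 with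
    | continuous =>
      change ℝ → ClosedLoopState n k at X
      change ℝ at t
      have h1' : HasDerivWithinAt (fun s => (X s).1) d.1 (Set.Ici 0) t := h1
      have h2' : HasDerivWithinAt (fun s => (X s).2) d.2 (Set.Ici 0) t := hasDerivWithinAt_pi.2 h2
      exact h1'.prodMk h2'
    | discrete => exact Prod.ext h1 (funext h2)

/-- Without feedthrough in the subsystems, the autonomous closed loop is a linear system. -/
theorem isClosedLoopTrajectory_iff {𝕋 : TimeDomain} (hD : ∀ i, (R i).D = 0)
    {X : 𝕋.Time → ClosedLoopState n k} :
    IsClosedLoopTrajectory 𝕋 plant R 0 0 0 0 X ↔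
      ∀ t, 0 ≤ t → HasSigma 𝕋 X (closedLoopMap plant R (X t)) t := by
  constructor
  · rintro ⟨y, u, z, v, h⟩ t ht
    obtain ⟨h1, h2, h3, h4, h5⟩ := h t ht
    -- Zero feedthrough breaks the algebraic loop: the command no longer depends on `u` or `z`.
    have hu : u t = command R (X t) := by
      funext i
      rw [(h5 i).2, hD i, Matrix.zero_mulVec, add_zero, command_apply]
    have hv : v t = command R (X t) := by rw [h3, hu]; exact add_zero _
    have hz : z t = measurement plant R (X t) := by
      rw [h4, h2, hv, measurement_apply]
      exact (zero_add _).trans (add_zero _)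
    rw [hasSigma_closedLoopState_iff]
    refine ⟨?_, fun i => ?_⟩
    · rw [closedLoopMap_fst, ← hv]
      exact h1
    · rw [closedLoopMap_snd, ← hu, ← hz]
      have h6 := (h5 i).1
      rwa [show u t + (0 : 𝕋.Time → Fin p → ℝ) t = u t from add_zero _] at h6
  · intro h
    refine ⟨fun t => measurement plant R (X t), fun t => command R (X t),
      fun t => measurement plant R (X t), fun t => command R (X t), fun t ht => ?_⟩
    obtain ⟨h1, h2⟩ := hasSigma_closedLoopState_iff.1 (h t ht)
    refine ⟨h1, (add_zero _).symm, (add_zero _).symm, (zero_add _).symm, fun i => ?_⟩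
    rw [show command R (X t) + (0 : 𝕋.Time → Fin p → ℝ) t = command R (X t) from add_zero _]
    refine ⟨?_, ?_⟩
    · rw [← closedLoopMap_snd]
      exact h2 i
    · rw [hD i, Matrix.zero_mulVec, add_zero]
      rfl

/-- An eigenvector of the closed-loop map solves the pencil equations of the plant and of the
controller's subsystems. -/
theorem notEigenvalue_closedLoopMap {l : ℂ} (hD : ∀ i, (R i).D = 0)
    (h : ∀ (x : Fin n → ℂ) (ξ : (i : Fin p) → Fin (k i) → ℂ) (u : Fin p → ℂ) (y : Fin m → ℂ),
      (cplx plant.A - l • 1) *ᵥ x + cplx plant.B *ᵥ u = 0 →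
      cplx plant.C *ᵥ x + cplx plant.D *ᵥ u = y →
      (∀ i, (cplx (R i).A - l • 1) *ᵥ ξ i + cplx (R i).B *ᵥ Sum.elim u y = 0) →
      (∀ i, (cplx (R i).C *ᵥ ξ i + cplx (R i).D *ᵥ Sum.elim u y) 0 = u i) →
      x = 0 ∧ ∀ i, ξ i = 0) :
    NotEigenvalue (closedLoopMap plant R) l := by
  intro a b ha hb
  have hx := h (complexVec a.1 b.1) (fun i => complexVec (a.2 i) (b.2 i))
    (complexVec (command R a) (command R b))
    (complexVec (measurement plant R a) (measurement plant R b)) ?_ ?_ (fun i => ?_) fun i => ?_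
  · obtain ⟨h1, h2⟩ := hx
    refine ⟨Prod.ext (complexVec_eq_zero h1).1 (funext fun i => (complexVec_eq_zero (h2 i)).1),
      Prod.ext (complexVec_eq_zero h1).2 (funext fun i => (complexVec_eq_zero (h2 i)).2)⟩
  · have ha1 := congrArg Prod.fst ha
    have hb1 := congrArg Prod.fst hb
    rw [closedLoopMap_fst] at ha1 hb1
    rw [Matrix.sub_mulVec, Matrix.smul_mulVec, Matrix.one_mulVec, sub_add_eq_add_sub, sub_eq_zero,
      cplx_mulVec_complexVec, cplx_mulVec_complexVec, complexVec_add, ha1, hb1, complexVec_smul]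
    rfl
  · rw [cplx_mulVec_complexVec, cplx_mulVec_complexVec, complexVec_add]
    rfl
  · have ha1 := congrFun (congrArg Prod.snd ha) i
    have hb1 := congrFun (congrArg Prod.snd hb) i
    rw [closedLoopMap_snd] at ha1 hb1
    rw [Matrix.sub_mulVec, Matrix.smul_mulVec, Matrix.one_mulVec, sub_add_eq_add_sub, sub_eq_zero,
      complexVec_sumElim, cplx_mulVec_complexVec, cplx_mulVec_complexVec, complexVec_add, ha1, hb1,
      complexVec_smul]
    rfl
  · rw [hD i, cplx_zero, Matrix.zero_mulVec, add_zero, cplx_mulVec_complexVec]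
    rfl

end ClosedLoop

end LTI

end

/-! ### The main theorem -/

theorem theorem4p6 (𝕋 : LTI.TimeDomain) (m p q n : ℕ)
    -- the plant
    (G : LTI.TFM (Fin m) (Fin p)) (plant : LTI.Realization (Fin n) (Fin p) (Fin m))
    (hG : plant.tfm = G) (hG_stab : plant.IsStabilizable 𝕋) (hG_det : plant.IsDetectable 𝕋)
    -- the stabilizing controller
    (K : LTI.TFM (Fin p) (Fin m)) (hK : LTI.IsStabilizingController 𝕋 K G)
    (A₁₁ : Matrix (Fin p) (Fin p) ℝ) (A₁₂ : Matrix (Fin p) (Fin q) ℝ)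
    (A₂₁ : Matrix (Fin q) (Fin p) ℝ) (A₂₂ : Matrix (Fin q) (Fin q) ℝ)
    (B₁ : Matrix (Fin p) (Fin m) ℝ) (B₂ : Matrix (Fin q) (Fin m) ℝ)
    (hK_tfm : (LTI.outputFirst A₁₁ A₁₂ A₂₁ A₂₂ B₁ B₂).tfm = K)
    (hK_min : (LTI.outputFirst A₁₁ A₁₂ A₂₁ A₂₂ B₁ B₂).IsMinimal)
    -- its stable SRTR pair
    (L : Matrix (Fin q) (Fin p) ℝ) (W : LTI.TFM (Fin p) (Fin p)) (V : LTI.TFM (Fin p) (Fin m))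
    (hWV : Matrix.fromCols W V = (LTI.srtrRealization A₁₁ A₁₂ A₂₁ A₂₂ B₁ B₂ L).tfm)
    (hW : LTI.IsStableTFM 𝕋 W) (hV : LTI.IsStableTFM 𝕋 V)
    -- realizations of the rows of the implementation
    (k : Fin p → ℕ) (R : (i : Fin p) → LTI.Realization (Fin (k i)) (Fin p ⊕ Fin m) (Fin 1))
    (hR : ∀ i, (R i).tfm = Matrix.replicateRow (Fin 1) (LTI.srtrImplementation W V i))
    (hR_stab : ∀ i, (R i).IsStabilizable 𝕋) (hR_det : ∀ i, (R i).IsDetectable 𝕋) :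
    LTI.ClosedLoopAsymptoticallyStable 𝕋 plant R := by
  have hD : ∀ i, (R i).D = 0 := fun i => LTI.feedthrough_eq_zero hWV (hR i)
  unfold LTI.ClosedLoopAsymptoticallyStable
  simp only [LTI.isClosedLoopTrajectory_iff plant R hD]
  refine LTI.asymptoticallyStable_of_notEigenvalue (LTI.closedLoopMap plant R) fun l hl => ?_
  refine LTI.notEigenvalue_closedLoopMap plant R hD fun x ξ u₀ y₀ hx hy hξ hu => ?_
  obtain ⟨v, y, hv, hy', hvy⟩ := plant.exists_tendsto_of_controllableAt (hG_stab l hl) hx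
  have hWV₀ : LTI.evalM (Matrix.fromCols W V) l *ᵥ Sum.elim u₀ y₀ = l • u₀ := by
    funext i
    rw [← LTI.mul_command_eq hl hW hV (hR i) (hR_stab i l hl) (hξ i), hu i]
    rfl
  -- As `[W V]` is continuous at `l`, the constant input `(u₀, y₀)` already realizes `(u₀, y₀) ↦ l •
  -- u₀` as a limiting pair.
  have hWVt : Filter.Tendsto (fun z => LTI.evalM (Matrix.fromCols W V) z *ᵥ Sum.elim u₀ y₀)
      (𝓝[≠] l) (𝓝 (l • u₀)) := by
    rw [← hWV₀]
    exact LTI.tendsto_mulVec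
      (((hW.fromCols hV).continuousAt_evalM hl).tendsto.mono_left nhdsWithin_le_nhds)
      tendsto_const_nhds
  obtain ⟨β, hβ₁, hβ₂⟩ := LTI.Realization.exists_state_of_observableAt
    (LTI.srtrRealization A₁₁ A₁₂ A₂₁ A₂₂ B₁ B₂ L)
    (LTI.observableAt_srtrRealization (hK_min.observableAt l)) tendsto_const_nhds hWVt
    (Filter.Eventually.of_forall fun z => by rw [hWV])
  obtain ⟨xK, hxK₁, hxK₂⟩ := LTI.exists_state_outputFirst hβ₁ hβ₂
  obtain ⟨z, u, hz, hu', hzu⟩ :=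
    LTI.Realization.exists_tendsto_of_controllableAt _ (hK_min.controllableAt l) hxK₁
  rw [hy] at hy'
  rw [hxK₂] at hu'
  rw [hG] at hvy
  rw [hK_tfm] at hzu
  -- Plant and controller now have the same limiting signals, which internal stability forces to
  -- vanish.
  obtain ⟨rfl, rfl⟩ := hK.eq_zero_of_tendsto hl hv hy' hvy hz hu' hzu
  have h0 : Sum.elim (0 : Fin p → ℂ) (0 : Fin m → ℂ) = 0 := by
    funext i
    rcases i with i | i <;> rfl
  rw [Matrix.mulVec_zero, add_zero] at hx hy
  refine ⟨(hG_det l hl).eq_zero hx hy, fun i => ?_⟩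
  have hξi := hξ i
  have hui := hu i
  rw [h0, Matrix.mulVec_zero, add_zero] at hξi hui
  refine (hR_det i l hl).eq_zero hξi (funext fun j => ?_)
  rw [Subsingleton.elim j 0]
  exact hui
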